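/- Let $\pi$ be a probability measure on $\{1,2,3,\dots\}$ with $\pi_i\ge \pi_{i+1}>0$ for all $i\ge 1$, where $\pi_i=\pi(\{i\})$, let $\xi_1,\xi_2,\dots$ be independent random variables with common law $\pi$, and put $$R_n=\#\{\xi_k:1\le k\le n\},\qquad \mu(t)=\sum_{i=1}^\infty\bigl(1-e^{-t\pi_i}\bigr)\quad(t\ge 0).$$ Let $\gamma\in(0,1)$ and suppose that $\pi$ is $\gamma$-regular, i.e. there is a strictly increasing function $\zeta:[0,\infty)\to[0,\infty)$ with $\lim_{x\to\infty}\zeta(\lambda x)/\zeta(x)=\lambda^\gamma$ for every $\lambda>0$ and $\lim_{n\to\infty}\pi_n\,\zeta^{-1}(n)=1$, where $\zeta^{-1}(y)=\inf\{x\ge 0:\zeta(x)\ge y\}$ (the ordinary inverse at every value of $\zeta$). Let $b(n)>0$ ($n\ge1$) satisfy $b(n)\to\infty$ and $\mu(n)/b(n)\to\infty$ as $n\to\infty$. Then $$Z_n=\frac{R_n-\mu(n)}{\sqrt{\mu(n)b(n)}}$$ satisfies a large deviation principle at speed $b(n)$ with rate function $I_\gamma(x)=\dfrac{x^2}{2(2^\gamma-1)}$.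 That is, $I_\gamma$ is lower semicontinuous with values in $[0,\infty]$, and for every Borel set $\Gamma\subset\mathbb R$, with interior $\Gamma^\circ$ and closure $\overline\Gamma$, $$-\inf_{x\in\Gamma^\circ} I_\gamma(x)\le\liminf_{n\to\infty}\frac{1}{b(n)}\log\mathbb P(Z_n\in\Gamma)\le\limsup_{n\to\infty}\frac{1}{b(n)}\log\mathbb P(Z_n\in\Gamma)\le-\inf_{x\in\overline\Gamma} I_\gamma(x),$$ with the conventions $\log 0=-\infty$ and $\inf\emptyset=+\infty$. -/

import Mathlib

open MeasureTheory ProbabilityTheory Filter Topology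

noncomputable section

/-- Every subset of `{1, 2, …}` is measurable. -/
instance instMeasurableSpacePNat : MeasurableSpace ℕ+ := ⊤

instance instDiscreteMeasurableSpacePNat : DiscreteMeasurableSpace ℕ+ := ⟨fun _ => trivial⟩

/-- The inverse of a strictly increasing function `ζ` on `[0, ∞)`: the infimum of the points `x ≥ 0`
with `ζ x ≥ y`. It is the ordinary inverse at every value of `ζ` (`increasingInverse_apply`); if `ζ`
is not surjective it is the usual monotone extension of the inverse to the gaps in the range. -/
def increasingInverse (ζ : ℝ → ℝ) (y : ℝ) : ℝ := sInf {x : ℝ | 0 ≤ x ∧ y ≤ ζ x}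

theorem increasingInverse_apply {ζ : ℝ → ℝ} (hζ : StrictMonoOn ζ (Set.Ici 0)) {x : ℝ}
    (hx : 0 ≤ x) : increasingInverse ζ (ζ x) = x := by
  have h : {z : ℝ | 0 ≤ z ∧ ζ x ≤ ζ z} = Set.Ici x := by
    ext z
    constructor
    · rintro ⟨hz, h⟩
      exact (hζ.le_iff_le hx hz).1 h
    · intro h
      have hz : 0 ≤ z := hx.trans h
      exact ⟨hz, (hζ.le_iff_le hx hz).2 h⟩
  rw [increasingInverse, h, csInf_Ici]

/-- `ζ : [0, ∞) → [0, ∞)` is strictly increasing and `ζ (c x) / ζ x → c ^ γ` as `x → ∞` for all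
`c > 0`. Values of `ζ` at negative arguments play no role. -/
structure IsRegularFunction (γ : ℝ) (ζ : ℝ → ℝ) : Prop where
  nonneg : ∀ x, 0 ≤ x → 0 ≤ ζ x
  strictMono : StrictMonoOn ζ (Set.Ici 0)
  tendsto_ratio : ∀ c : ℝ, 0 < c → Tendsto (fun x => ζ (c * x) / ζ x) atTop (𝓝 (c ^ γ))

/-- A distribution `π` on `{1, 2, …}` is `γ`-regular if `π_n ζ⁻¹(n) → 1` for some `γ`-regular
function `ζ`. -/
def IsRegularDistribution (γ : ℝ) (π : Measure ℕ+) : Prop :=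
  ∃ ζ : ℝ → ℝ, IsRegularFunction γ ζ ∧
    Tendsto (fun n : ℕ+ => π.real {n} * increasingInverse ζ ((n : ℕ) : ℝ)) atTop (𝓝 1)

/-- `μ(t) = ∑_{i ≥ 1} (1 - exp (-t π_i))`. -/
def muFun (π : Measure ℕ+) (t : ℝ) : ℝ := ∑' i : ℕ+, (1 - Real.exp (-t * π.real {i}))

/-- `R_n`, the number of distinct values among the first `n` samples. The samples are
enumerated from `0`, so the first `n` of them are `ξ 0, …, ξ (n - 1)`. -/
def rangeCount {Ω : Type*} (ξ : ℕ → Ω → ℕ+) (n : ℕ) (ω : Ω) : ℕ :=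
  ((Finset.range n).image (fun k => ξ k ω)).card

/-- `Z_n = (R_n - μ(n)) / √(μ(n) b(n))`. -/
def normalizedRange {Ω : Type*} (π : Measure ℕ+) (ξ : ℕ → Ω → ℕ+) (b : ℕ → ℝ) (n : ℕ) (ω : Ω) : ℝ :=
  ((rangeCount ξ n ω : ℝ) - muFun π n) / √(muFun π n * b n)

/-- The real random variables `Z n` satisfy the large deviation principle under `P` with speed `b`
and rate function `I`: `I` is lower semicontinuous with values in `[0, ∞]` and for every Borel set
`Γ`, `-inf_{Γ°} I ≤ liminf (1 / b n) log P (Z n ∈ Γ)` and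
`limsup (1 / b n) log P (Z n ∈ Γ) ≤ -inf_{closure Γ} I`. Here `log 0 = -∞` and `inf ∅ = +∞`. -/
structure SatisfiesLDP {Ω : Type*} [MeasurableSpace Ω] (P : Measure Ω) (Z : ℕ → Ω → ℝ)
    (b : ℕ → ℝ) (I : ℝ → EReal) : Prop where
  nonneg : ∀ x, 0 ≤ I x
  lowerSemicontinuous : LowerSemicontinuous I
  lower_bound : ∀ Γ : Set ℝ, MeasurableSet Γ →
    -(⨅ x ∈ interior Γ, I x) ≤
      liminf (fun n => ENNReal.log (P {ω | Z n ω ∈ Γ}) / (b n : EReal)) atTop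
  upper_bound : ∀ Γ : Set ℝ, MeasurableSet Γ →
    limsup (fun n => ENNReal.log (P {ω | Z n ω ∈ Γ}) / (b n : EReal)) atTop ≤
      -(⨅ x ∈ closure Γ, I x)

end

/-! ### The mean function `muFun` -/

/-! Sample at an independent Poisson time of mean `t`. The events "value `i` has been seen" are then
independent with probabilities `q_i = 1 - exp (-t π_i)`, so the moment generating function of the
range is the product of the factors `1 + (e^θ - 1) q_i` (`poissonizedMgf_eq_exp_tsum`). For small
`θ` its logarithm is `θ ∑ q_i + θ²/2 ∑ q_i (1 - q_i)` up to `O(|θ|³ ∑ q_i)`. The first sum is `μ(t)`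
and the second is exactly `μ(2t) - μ(t)`, because `q (1 - q) = e^{-tp} - e^{-2tp}`
(`abs_log_poissonizedMgf_sub_le`). Regularity enters only through `μ(2t)/μ(t) → 2^γ`
(`tendsto_muFun_two_mul_div`), which makes the variance asymptotic to `(2^γ - 1) μ(t)`. With `θ = u
√(b/μ)` the centred logarithm divided by `b` tends to `(2^γ - 1) u²/2`.

To return to a fixed time `n`, use that the range is monotone in time and compare with Poisson times
of mean `(1 ± ε) n`. The Poisson variable falls on the wrong side of `n` with probability at most
`exp (-n ε²/8)`, negligible at speed `b` when `ε ≫ √(b/n)`. By concavity the shift changes `μ` by at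
most `ε μ`, hence `θ μ` by `o(b)` when `ε ≪ √(b/μ)`. Both are possible since `μ(n) = o(n)`. This
gives `tendsto_cgf_rangeCount`, and a Gärtner–Ellis argument for a quadratic limit
(`satisfiesLDP_of_tendsto_cgf`) concludes. -/

theorem hasSum_measureReal_singleton (π : Measure ℕ+) [IsProbabilityMeasure π] :
    HasSum (fun i : ℕ+ => π.real {i}) 1 := by
  have h := Measure.tsum_indicator_apply_singleton π Set.univ MeasurableSet.univ
  simp only [Set.indicator_univ, measure_univ] at h
  have hs : Summable (fun i : ℕ+ => π.real {i}) :=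
    ENNReal.summable_toReal (by rw [h]; exact ENNReal.one_ne_top)
  have : ∑' i : ℕ+, π.real {i} = 1 := by
    have h2 := ENNReal.tsum_toReal_eq (f := fun i : ℕ+ => π {i}) (fun i => measure_ne_top _ _)
    rw [h] at h2
    simpa [Measure.real] using h2.symm
  exact this ▸ hs.hasSum

theorem one_sub_exp_neg_nonneg {t p : ℝ} (ht : 0 ≤ t) (hp : 0 ≤ p) : 0 ≤ 1 - Real.exp (-t * p) := by
  have : Real.exp (-t * p) ≤ 1 := Real.exp_le_one_iff.2 (by nlinarith)
  linarith

theorem one_sub_exp_neg_le (t p : ℝ) : 1 - Real.exp (-t * p) ≤ t * p := by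
  have := Real.add_one_le_exp (-t * p)
  linarith

theorem summable_muFun (π : Measure ℕ+) [IsProbabilityMeasure π] {t : ℝ} (ht : 0 ≤ t) :
    Summable (fun i : ℕ+ => 1 - Real.exp (-t * π.real {i})) :=
  Summable.of_nonneg_of_le (fun _ => one_sub_exp_neg_nonneg ht measureReal_nonneg)
    (fun _ => one_sub_exp_neg_le t _) ((hasSum_measureReal_singleton π).summable.mul_left t)

theorem muFun_nonneg (π : Measure ℕ+) {t : ℝ} (ht : 0 ≤ t) : 0 ≤ muFun π t :=
  tsum_nonneg fun _ => one_sub_exp_neg_nonneg ht measureReal_nonneg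

theorem muFun_zero (π : Measure ℕ+) : muFun π 0 = 0 := by simp [muFun]

theorem muFun_mono (π : Measure ℕ+) [IsProbabilityMeasure π] {s t : ℝ} (hs : 0 ≤ s)
    (hst : s ≤ t) : muFun π s ≤ muFun π t := by
  refine (summable_muFun π hs).tsum_le_tsum (fun i => ?_) (summable_muFun π (hs.trans hst))
  have : Real.exp (-t * π.real {i}) ≤ Real.exp (-s * π.real {i}) :=
    Real.exp_le_exp.2 (by nlinarith [measureReal_nonneg (μ := π) (s := {i})])
  linarith

theorem concaveOn_muFun (π : Measure ℕ+) [IsProbabilityMeasure π] :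
    ConcaveOn ℝ (Set.Ici 0) (muFun π) := by
  refine ⟨convex_Ici 0, fun x hx y hy a b ha hb hab => ?_⟩
  have hx' : 0 ≤ x := hx
  have hy' : 0 ≤ y := hy
  have hxy : 0 ≤ a * x + b * y := by positivity
  have hsum := ((summable_muFun π hx').mul_left a).add ((summable_muFun π hy').mul_left b)
  have h := hsum.tsum_le_tsum (fun i => ?_) (summable_muFun π hxy)
  · rw [Summable.tsum_add ((summable_muFun π hx').mul_left a) ((summable_muFun π hy').mul_left b),
      tsum_mul_left, tsum_mul_left] at h
    exact h
  · have := convexOn_exp.2 (Set.mem_univ (-x * π.real {i})) (Set.mem_univ (-y * π.real {i})) ha hb hab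
    simp only [smul_eq_mul] at this
    rw [show a * (-x * π.real {i}) + b * (-y * π.real {i}) = -(a * x + b * y) * π.real {i} by ring]
      at this
    nlinarith

theorem muFun_mul_le (π : Measure ℕ+) [IsProbabilityMeasure π] {c t : ℝ} (hc : 1 ≤ c)
    (ht : 0 ≤ t) : muFun π (c * t) ≤ c * muFun π t := by
  have hc0 : 0 < c := by linarith
  have h := (concaveOn_muFun π).2 (Set.mem_Ici.2 le_rfl) (Set.mem_Ici.2 (by positivity : 0 ≤ c * t))
    (sub_nonneg.2 (inv_le_one_of_one_le₀ hc)) (inv_nonneg.2 hc0.le) (by ring)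
  simp only [smul_eq_mul, muFun_zero, mul_zero, zero_add] at h
  rw [inv_mul_cancel_left₀ hc0.ne', inv_mul_le_iff₀ hc0] at h
  exact h

theorem mul_muFun_le (π : Measure ℕ+) [IsProbabilityMeasure π] {c t : ℝ} (hc0 : 0 ≤ c)
    (hc : c ≤ 1) (ht : 0 ≤ t) : c * muFun π t ≤ muFun π (c * t) := by
  have h := (concaveOn_muFun π).2 (Set.mem_Ici.2 le_rfl) (Set.mem_Ici.2 ht)
    (sub_nonneg.2 hc) hc0 (by ring)
  simpa only [smul_eq_mul, muFun_zero, mul_zero, zero_add] using h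

/-- Concavity together with `μ(0) = 0`: a relative change of time produces at most the same relative
change of the mean. This controls the cost of perturbing the Poisson time. -/
theorem abs_muFun_sub_le (π : Measure ℕ+) [IsProbabilityMeasure π] {η t : ℝ} (hη : |η| ≤ 1)
    (ht : 0 ≤ t) : |muFun π ((1 + η) * t) - muFun π t| ≤ |η| * muFun π t := by
  rw [abs_le] at hη
  rcases le_total 0 η with h | h
  · have h1 := muFun_mul_le π (c := 1 + η) (by linarith) ht
    have h2 := muFun_mono π ht (t := (1 + η) * t) (by nlinarith)
    rw [abs_of_nonneg (by linarith), abs_of_nonneg h]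
    linarith
  · have h1 := mul_muFun_le π (c := 1 + η) (by linarith) (by linarith) ht
    have h2 := muFun_mono π (s := (1 + η) * t) (t := t) (by nlinarith) (by nlinarith)
    rw [abs_of_nonpos (by linarith), abs_of_nonpos h]
    linarith

/-- Dominated convergence with the summable bound `π_i`, each term being at most `1/t`. It leaves
room between the scales `√(b/n)` and `√(b/μ)`. -/
theorem tendsto_muFun_div_atTop (π : Measure ℕ+) [IsProbabilityMeasure π] :
    Tendsto (fun t : ℝ => muFun π t / t) atTop (𝓝 0) := by
  have h : Tendsto (fun t : ℝ => ∑' i : ℕ+, (1 - Real.exp (-t * π.real {i})) / t) atTop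
      (𝓝 (∑' _ : ℕ+, (0 : ℝ))) := by
    refine tendsto_tsum_of_dominated_convergence (bound := fun i : ℕ+ => π.real {i})
      (hasSum_measureReal_singleton π).summable (fun i => ?_) ?_
    · refine squeeze_zero' (g := fun t : ℝ => t⁻¹) ?_ ?_ tendsto_inv_atTop_zero
      · filter_upwards [eventually_gt_atTop 0] with t ht
        exact div_nonneg (one_sub_exp_neg_nonneg ht.le measureReal_nonneg) ht.le
      · filter_upwards [eventually_gt_atTop 0] with t ht
        rw [div_eq_mul_inv]
        exact mul_le_of_le_one_left (inv_nonneg.2 ht.le) (by linarith [Real.exp_pos (-t * π.real {i})])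
    · filter_upwards [eventually_gt_atTop 0] with t ht i
      rw [Real.norm_of_nonneg (div_nonneg (one_sub_exp_neg_nonneg ht.le measureReal_nonneg) ht.le),
        div_le_iff₀ ht, mul_comm (π.real {i})]
      exact one_sub_exp_neg_le t _
  rw [tsum_zero] at h
  refine h.congr fun t => ?_
  rw [muFun, tsum_div_const]

/-! ### The counting function of a distribution -/

/-- The number of `i` with `1 ≤ x π_i`. -/
noncomputable def atomCount (π : Measure ℕ+) (x : ℝ) : ℕ := {i : ℕ+ | 1 ≤ x * π.real {i}}.ncard

theorem finite_atoms (π : Measure ℕ+) [IsProbabilityMeasure π] (x : ℝ) :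
    {i : ℕ+ | 1 ≤ x * π.real {i}}.Finite := by
  have h := ((hasSum_measureReal_singleton π).summable.mul_left x).tendsto_cofinite_zero
  have h1 := h.eventually (gt_mem_nhds (zero_lt_one (α := ℝ)))
  refine (Filter.eventually_cofinite.1 h1).subset fun i hi => ?_
  exact not_lt.2 hi

theorem atomCount_mono (π : Measure ℕ+) [IsProbabilityMeasure π] : Monotone (atomCount π) :=
  fun x y hxy => Set.ncard_le_ncard (fun i hi => le_trans (show 1 ≤ x * π.real {i} from hi)
    (mul_le_mul_of_nonneg_right hxy measureReal_nonneg)) (finite_atoms π y)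

/-- Since the weights are nonincreasing, the atoms counted form an initial segment, so the counting
function is a generalized inverse of `n ↦ 1/π_n`. -/
theorem le_atomCount_iff (π : Measure ℕ+) [IsProbabilityMeasure π]
    (hanti : Antitone fun i : ℕ+ => π.real {i}) {x : ℝ} (hx : 0 ≤ x) (n : ℕ+) :
    (n : ℕ) ≤ atomCount π x ↔ 1 ≤ x * π.real {n} := by
  constructor
  · intro h
    by_contra hn
    have hsub : {i : ℕ+ | 1 ≤ x * π.real {i}} ⊆ (Finset.Ico 1 n : Finset ℕ+) := by
      intro i hi
      simp only [Finset.coe_Ico, Set.mem_Ico, one_le, true_and]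
      by_contra hin
      exact hn (le_trans hi (mul_le_mul_of_nonneg_left (hanti (not_lt.1 hin)) hx))
    have h1 := Set.ncard_le_ncard hsub (Finset.finite_toSet _)
    rw [Set.ncard_coe_finset, PNat.card_Ico, PNat.one_coe] at h1
    have h2 : (n : ℕ) ≤ (n : ℕ) - 1 := h.trans h1
    have := n.pos
    omega
  · intro h
    have hsub : ((Finset.Icc 1 n : Finset ℕ+) : Set ℕ+) ⊆ {i : ℕ+ | 1 ≤ x * π.real {i}} := by
      intro i hi
      simp only [Finset.coe_Icc, Set.mem_Icc, one_le, true_and] at hi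
      exact le_trans h (mul_le_mul_of_nonneg_left (hanti hi) hx)
    have h1 := Set.ncard_le_ncard hsub (finite_atoms π x)
    rw [Set.ncard_coe_finset, PNat.card_Icc, PNat.one_coe] at h1
    simpa [atomCount] using h1

theorem tendsto_atomCount_atTop (π : Measure ℕ+) [IsProbabilityMeasure π]
    (hpos : ∀ i : ℕ+, 0 < π.real {i}) (hanti : Antitone fun i : ℕ+ => π.real {i}) :
    Tendsto (atomCount π) atTop atTop := by
  refine tendsto_atTop.2 fun n => ?_
  filter_upwards [eventually_ge_atTop (π.real {n.succPNat})⁻¹] with x hx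
  have hp := hpos n.succPNat
  have h := (le_atomCount_iff π hanti (x := x) ((inv_pos.2 hp).le.trans hx) n.succPNat).2 ?_
  · simp only [Nat.succPNat_coe] at h
    omega
  · rw [← inv_mul_cancel₀ hp.ne']
    exact mul_le_mul_of_nonneg_right hx hp.le

/-! ### The mean as an exponential average of the counting function -/

theorem tsum_ite_eq_atomCount (π : Measure ℕ+) [IsProbabilityMeasure π] (x : ℝ) :
    ∑' i : ℕ+, (if 1 ≤ x * π.real {i} then (1 : ENNReal) else 0) = (atomCount π x : ENNReal) := by
  classical
  rw [tsum_eq_sum (s := (finite_atoms π x).toFinset) (fun i hi => by simpa using hi)]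
  rw [Finset.sum_congr rfl (g := fun _ => (1 : ENNReal)) (fun i hi => by simpa using hi)]
  rw [Finset.sum_const, nsmul_eq_mul, mul_one, atomCount, Set.ncard_eq_toFinset_card _ (finite_atoms π x)]

theorem lintegral_exp_neg_indicator {c : ℝ} (hc : 0 ≤ c) :
    ∫⁻ v in Set.Ioi (0 : ℝ), ENNReal.ofReal (Real.exp (-v)) * (if v ≤ c then 1 else 0)
      = ENNReal.ofReal (1 - Real.exp (-c)) := by
  have h1 : ∀ v : ℝ, ENNReal.ofReal (Real.exp (-v)) * (if v ≤ c then 1 else 0)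
      = (Set.Iic c).indicator (fun v => ENNReal.ofReal (Real.exp (-v))) v := by
    intro v
    by_cases hv : v ≤ c <;> simp [hv]
  simp_rw [h1]
  rw [lintegral_indicator measurableSet_Iic, Measure.restrict_restrict measurableSet_Iic,
    Set.inter_comm, Set.Ioi_inter_Iic, ← ofReal_integral_eq_lintegral_ofReal,
    ← intervalIntegral.integral_of_le hc, intervalIntegral.integral_comp_neg (fun x => Real.exp x),
    integral_exp]
  · simp
  · exact (Continuous.integrableOn_Ioc (by fun_prop))
  · exact Eventually.of_forall fun v => (Real.exp_pos _).le

/-- Write `1 - e^{-tp}` as the integral of `e^{-v}` over `0 < v ≤ tp` and exchange sum and integral;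
`v ≤ t p` is the condition `1 ≤ (t/v) p`. -/
theorem ofReal_muFun_eq_lintegral (π : Measure ℕ+) [IsProbabilityMeasure π] {t : ℝ} (ht : 0 ≤ t) :
    ENNReal.ofReal (muFun π t)
      = ∫⁻ v in Set.Ioi (0 : ℝ), ENNReal.ofReal (Real.exp (-v)) * (atomCount π (t / v) : ENNReal) := by
  rw [muFun, ENNReal.ofReal_tsum_of_nonneg
    (fun _ => one_sub_exp_neg_nonneg ht measureReal_nonneg) (summable_muFun π ht)]
  have h1 : ∀ i : ℕ+, ENNReal.ofReal (1 - Real.exp (-t * π.real {i}))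
      = ∫⁻ v in Set.Ioi (0 : ℝ), ENNReal.ofReal (Real.exp (-v))
          * (if v ≤ t * π.real {i} then 1 else 0) := by
    intro i
    rw [lintegral_exp_neg_indicator (mul_nonneg ht measureReal_nonneg), neg_mul]
  simp_rw [h1]
  rw [← lintegral_tsum]
  · refine setLIntegral_congr_fun measurableSet_Ioi fun v hv => ?_
    have hv' : 0 < v := hv
    rw [ENNReal.tsum_mul_left, ← tsum_ite_eq_atomCount]
    congr 2
    ext i
    congr 1
    rw [div_mul_eq_mul_div, le_div_iff₀ hv', one_mul]
  · intro i
    refine ((Measurable.ennreal_ofReal (by fun_prop)).mul ?_).aemeasurable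
    exact Measurable.ite measurableSet_Iic measurable_const measurable_const

theorem lintegral_exp_neg_Ioi_zero :
    ∫⁻ v in Set.Ioi (0 : ℝ), ENNReal.ofReal (Real.exp (-v)) = 1 := by
  rw [← ofReal_integral_eq_lintegral_ofReal, integral_exp_neg_Ioi]
  · simp
  · exact (exp_neg_integrableOn_Ioi 0 one_pos).congr_fun (fun x _ => by simp) measurableSet_Ioi
  · exact Eventually.of_forall fun v => (Real.exp_pos _).le

theorem mul_muFun_le_of_atomCount_le (π : Measure ℕ+) [IsProbabilityMeasure π] {a a' c c' K t : ℝ}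
    (ha : 0 ≤ a) (ha' : 0 ≤ a') (hc : 0 ≤ c) (hc' : 0 ≤ c') (hK : 0 ≤ K) (ht : 0 ≤ t)
    (h : ∀ x, 0 ≤ x → a * atomCount π (c * x) ≤ a' * atomCount π (c' * x) + K) :
    a * muFun π (c * t) ≤ a' * muFun π (c' * t) + K := by
  have hm : ∀ s : ℝ, 0 ≤ s → Measurable fun v : ℝ => ENNReal.ofReal (Real.exp (-v))
      * (atomCount π (s / v) : ENNReal) := by
    intro s _
    refine (Measurable.ennreal_ofReal (by fun_prop)).mul ?_
    have h1 : Measurable (fun x : ℝ => (atomCount π x : ENNReal)) :=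
      (Nat.mono_cast.comp (atomCount_mono π)).measurable
    exact h1.comp (measurable_const.div measurable_id)
  have key : ENNReal.ofReal a * ENNReal.ofReal (muFun π (c * t))
      ≤ ENNReal.ofReal a' * ENNReal.ofReal (muFun π (c' * t)) + ENNReal.ofReal K := by
    rw [ofReal_muFun_eq_lintegral π (mul_nonneg hc ht), ofReal_muFun_eq_lintegral π (mul_nonneg hc' ht),
      ← lintegral_const_mul _ (hm _ (mul_nonneg hc ht)),
      ← lintegral_const_mul _ (hm _ (mul_nonneg hc' ht)),
      ← mul_one (ENNReal.ofReal K), ← lintegral_exp_neg_Ioi_zero,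
      ← lintegral_const_mul (ENNReal.ofReal K) (f := fun v : ℝ => ENNReal.ofReal (Real.exp (-v)))
        (by fun_prop),
      ← lintegral_add_left ((hm _ (mul_nonneg hc' ht)).const_mul _)]
    refine setLIntegral_mono' measurableSet_Ioi fun v hv => ?_
    have hv' : 0 < v := hv
    have hx := h (t / v) (by positivity)
    rw [← mul_div_assoc, ← mul_div_assoc] at hx
    rw [← ENNReal.ofReal_natCast, ← ENNReal.ofReal_natCast, ← ENNReal.ofReal_mul (Real.exp_pos _).le,
      ← ENNReal.ofReal_mul (Real.exp_pos _).le, ← ENNReal.ofReal_mul ha, ← ENNReal.ofReal_mul ha',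
      ← ENNReal.ofReal_mul hK, ← ENNReal.ofReal_add (by positivity) (by positivity)]
    refine ENNReal.ofReal_le_ofReal ?_
    nlinarith [Real.exp_pos (-v)]
  have h0 := muFun_nonneg π (mul_nonneg hc' ht)
  rw [← ENNReal.ofReal_mul ha, ← ENNReal.ofReal_mul ha',
    ← ENNReal.ofReal_add (by positivity) hK, ENNReal.ofReal_le_ofReal_iff (by positivity)] at key
  exact key

/-- An Abelian argument: beyond some `x₀` the ratio of counts is close to `ρ`, below `x₀` the counts
are bounded. The resulting inequality with an additive constant integrates to one for `μ`, where the
constant is negligible because `μ → ∞`. -/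
theorem tendsto_muFun_ratio (π : Measure ℕ+) [IsProbabilityMeasure π] {ρ c : ℝ} (hρ : 0 < ρ)
    (hc : 0 < c)
    (hN : Tendsto (fun x : ℝ => (atomCount π (c * x) : ℝ) / atomCount π x) atTop (𝓝 ρ))
    (hNpos : ∀ᶠ x : ℝ in atTop, 0 < atomCount π x) (hμ : Tendsto (muFun π) atTop atTop) :
    Tendsto (fun t => muFun π (c * t) / muFun π t) atTop (𝓝 ρ) := by
  refine tendsto_order.2 ⟨fun a ha => ?_, fun a ha => ?_⟩
  -- The maximum with `0` keeps `a'` positive even when `a` is negative.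
  · obtain ⟨a', ha', ha'ρ⟩ := exists_between (max_lt ha hρ)
    rw [max_lt_iff] at ha'
    obtain ⟨x₀, hx₀⟩ := eventually_atTop.1 ((hN.eventually (lt_mem_nhds ha'ρ)).and hNpos)
    have hineq : ∀ x, 0 ≤ x → a' * atomCount π (1 * x)
        ≤ 1 * atomCount π (c * x) + a' * atomCount π x₀ := by
      intro x _
      rw [one_mul, one_mul]
      rcases le_total x₀ x with hx | hx
      · have := hx₀ x hx
        have h1 := (lt_div_iff₀ (by exact_mod_cast this.2)).1 this.1
        have h2 : 0 ≤ a' * (atomCount π x₀ : ℝ) := by have := ha'.2; positivity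
        linarith
      · have h1 : (atomCount π x : ℝ) ≤ atomCount π x₀ := by exact_mod_cast atomCount_mono π hx
        have h2 : (0 : ℝ) ≤ atomCount π (c * x) := by positivity
        nlinarith [ha'.2]
    filter_upwards [hμ.eventually_gt_atTop (a' * atomCount π x₀ / (a' - a)),
      hμ.eventually_gt_atTop 0, eventually_ge_atTop 0] with t h1 h2 ht
    have h3 := mul_muFun_le_of_atomCount_le π ha'.2.le zero_le_one zero_le_one hc.le
      (mul_nonneg ha'.2.le (Nat.cast_nonneg _)) ht hineq
    rw [lt_div_iff₀ h2]
    rw [div_lt_iff₀ (by linarith [ha'.1])] at h1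
    rw [one_mul, one_mul] at h3
    nlinarith
  · obtain ⟨a', ha', ha'a⟩ := exists_between ha
    have ha'0 : 0 < a' := hρ.trans ha'
    obtain ⟨x₀, hx₀⟩ := eventually_atTop.1 ((hN.eventually (gt_mem_nhds ha')).and hNpos)
    have hineq : ∀ x, 0 ≤ x → 1 * atomCount π (c * x)
        ≤ a' * atomCount π (1 * x) + atomCount π (c * x₀) := by
      intro x _
      rw [one_mul, one_mul]
      rcases le_total x₀ x with hx | hx
      · have := hx₀ x hx
        have h1 := (div_lt_iff₀ (by exact_mod_cast this.2)).1 this.1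
        have h2 : 0 ≤ (atomCount π (c * x₀) : ℝ) := by positivity
        linarith
      · have h1 : (atomCount π (c * x) : ℝ) ≤ atomCount π (c * x₀) := by
          exact_mod_cast atomCount_mono π (mul_le_mul_of_nonneg_left hx hc.le)
        have h2 : (0 : ℝ) ≤ a' * atomCount π x := by positivity
        linarith
    filter_upwards [hμ.eventually_gt_atTop (atomCount π (c * x₀) / (a - a')),
      hμ.eventually_gt_atTop 0, eventually_ge_atTop 0] with t h1 h2 ht
    have h3 := mul_muFun_le_of_atomCount_le π zero_le_one ha'0.le hc.le zero_le_one
      (Nat.cast_nonneg _) ht hineq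
    rw [div_lt_iff₀ h2]
    rw [div_lt_iff₀ (by linarith)] at h1
    rw [one_mul, one_mul] at h3
    nlinarith

/-! ### Regular variation of the counting function -/

/-- Eventually each doubling of the argument multiplies `ζ` by at least a fixed `q > 1`, because `2
^ γ > 1`; monotonicity fills the gaps. -/
theorem IsRegularFunction.tendsto_atTop {γ : ℝ} {ζ : ℝ → ℝ} (hζ : IsRegularFunction γ ζ)
    (hγ : 0 < γ) : Tendsto ζ atTop atTop := by
  have h2 : (1 : ℝ) < 2 ^ γ := Real.one_lt_rpow one_lt_two hγ
  obtain ⟨q, hq1, hq2⟩ := exists_between h2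
  obtain ⟨x₀, hx₀⟩ := eventually_atTop.1 ((hζ.tendsto_ratio 2 two_pos).eventually (lt_mem_nhds hq2))
  set y := max x₀ 1 with hy
  have hy1 : 1 ≤ y := le_max_right _ _
  have hpos : ∀ x, 1 ≤ x → 0 < ζ x := fun x hx =>
    (hζ.nonneg 0 le_rfl).trans_lt
      (hζ.strictMono (Set.mem_Ici.2 le_rfl) (Set.mem_Ici.2 (by linarith)) (by linarith))
  have hk : ∀ k : ℕ, q ^ k * ζ y ≤ ζ (2 ^ k * y) := by
    intro k
    induction k with
    | zero => simp
    | succ k ih =>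
      have hge : y ≤ 2 ^ k * y := le_mul_of_one_le_left (by linarith) (one_le_pow₀ one_le_two)
      have h1 := hx₀ (2 ^ k * y) ((le_max_left _ _).trans hge)
      rw [lt_div_iff₀ (hpos _ (hy1.trans hge))] at h1
      rw [pow_succ, pow_succ', mul_assoc 2]
      nlinarith [mul_le_mul_of_nonneg_left ih (by linarith : 0 ≤ q)]
  refine Filter.tendsto_atTop.2 fun M => ?_
  obtain ⟨k, hk'⟩ := ((tendsto_pow_atTop_atTop_of_one_lt hq1).eventually_ge_atTop (M / ζ y)).exists
  filter_upwards [eventually_ge_atTop (2 ^ k * y)] with x hx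
  rw [div_le_iff₀ (hpos y hy1)] at hk'
  have hy0 : 0 ≤ 2 ^ k * y := by positivity
  exact hk'.trans ((hk k).trans
    (hζ.strictMono.monotoneOn (Set.mem_Ici.2 hy0) (Set.mem_Ici.2 (hy0.trans hx)) hx))

theorem increasingInverse_le {ζ : ℝ → ℝ} {x y : ℝ} (hx : 0 ≤ x) (h : y ≤ ζ x) :
    increasingInverse ζ y ≤ x :=
  csInf_le ⟨0, fun _ hz => hz.1⟩ ⟨hx, h⟩

theorem le_increasingInverse {ζ : ℝ → ℝ} (hζ : MonotoneOn ζ (Set.Ici 0))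
    (hζt : Tendsto ζ atTop atTop) {x y : ℝ} (hx : 0 ≤ x) (h : ζ x < y) :
    x ≤ increasingInverse ζ y := by
  refine le_csInf ?_ fun z hz => ?_
  · obtain ⟨z, hz⟩ := ((hζt.eventually_ge_atTop y).and (eventually_ge_atTop 0)).exists
    exact ⟨z, hz.2, hz.1⟩
  · by_contra hzx
    exact absurd (hz.2.trans (hζ (Set.mem_Ici.2 hz.1) (Set.mem_Ici.2 hx) (not_le.1 hzx).le))
      (not_le.2 h)

/-- Inverting the asymptotics `π_n ζ⁻¹(n) → 1`: with `N` the counting function, one has `x π_n ≥ 1`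
at `n = N(x)` and `x π_n < 1` at `n = N(x) + 1`. Comparing `n` with `ζ (c x)` for `c` on either side
of `1` and letting `c → 1` gives both bounds. -/
theorem tendsto_atomCount_div {γ : ℝ} (hγ : 0 < γ) (π : Measure ℕ+) [IsProbabilityMeasure π]
    (hpos : ∀ i : ℕ+, 0 < π.real {i}) (hanti : Antitone fun i : ℕ+ => π.real {i}) {ζ : ℝ → ℝ}
    (hζ : IsRegularFunction γ ζ)
    (hπζ : Tendsto (fun n : ℕ+ => π.real {n} * increasingInverse ζ ((n : ℕ) : ℝ)) atTop (𝓝 1)) :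
    Tendsto (fun x : ℝ => (atomCount π x : ℝ) / ζ x) atTop (𝓝 1) := by
  have hζt := hζ.tendsto_atTop hγ
  have hmono := hζ.strictMono.monotoneOn
  have hNt := tendsto_atomCount_atTop π hpos hanti
  have hcont : Tendsto (fun c : ℝ => c ^ γ) (𝓝 1) (𝓝 1) := by
    have := (Real.continuousAt_rpow_const 1 γ (Or.inl one_ne_zero)).tendsto
    rwa [Real.one_rpow] at this
  refine tendsto_order.2 ⟨fun a ha => ?_, fun a ha => ?_⟩
  · have h1 : ∀ᶠ c : ℝ in 𝓝[<] 1, a < c ^ γ ∧ 0 < c ∧ c < 1 :=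
      ((hcont.eventually (lt_mem_nhds ha)).filter_mono nhdsWithin_le_nhds).and
        ((Filter.Eventually.filter_mono nhdsWithin_le_nhds (lt_mem_nhds zero_lt_one)).and self_mem_nhdsWithin)
    obtain ⟨c, hac, hc0, hc1⟩ := h1.exists
    obtain ⟨n₀, hn₀⟩ := eventually_atTop.1 (hπζ.eventually (lt_mem_nhds hc1))
    -- The subtracted `1 / ζ x` absorbs the `+ 1` in `n = N(x) + 1`.
    have hlim : Tendsto (fun x => ζ (c * x) / ζ x - (ζ x)⁻¹) atTop (𝓝 (c ^ γ - 0)) :=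
      (hζ.tendsto_ratio c hc0).sub hζt.inv_tendsto_atTop
    rw [sub_zero] at hlim
    filter_upwards [hlim.eventually (lt_mem_nhds hac), hζt.eventually_gt_atTop 0,
      hNt.eventually_ge_atTop n₀, eventually_gt_atTop 0] with x h1 h2 h3 hx
    refine h1.trans_le ?_
    rw [← one_div, ← sub_div]
    refine div_le_div_of_nonneg_right ?_ h2.le
    set n := (atomCount π x).succPNat with hn
    have hn1 : ((n : ℕ) : ℝ) = atomCount π x + 1 := by simp [hn]
    have hlt : x * π.real {n} < 1 := by
      rw [← not_le, ← le_atomCount_iff π hanti hx.le, hn, Nat.succPNat_coe]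
      omega
    have hge : n₀ ≤ n := by
      rw [← PNat.coe_le_coe, hn, Nat.succPNat_coe]; omega
    have h4 := hn₀ n hge
    have h5 : ζ (c * x) < n := by
      by_contra h
      have h6 := increasingInverse_le (by positivity) (not_lt.1 h)
      nlinarith [mul_le_mul_of_nonneg_left h6 (hpos n).le]
    rw [hn1] at h5
    linarith
  · have h1 : ∀ᶠ c : ℝ in 𝓝[>] 1, c ^ γ < a ∧ 1 < c :=
      ((hcont.eventually (gt_mem_nhds ha)).filter_mono nhdsWithin_le_nhds).and self_mem_nhdsWithin
    obtain ⟨c, hac, hc1⟩ := h1.exists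
    obtain ⟨n₀, hn₀⟩ := eventually_atTop.1 (hπζ.eventually (gt_mem_nhds hc1))
    filter_upwards [(hζ.tendsto_ratio c (by linarith)).eventually (gt_mem_nhds hac),
      hζt.eventually_gt_atTop 0,
      hNt.eventually_ge_atTop n₀, eventually_gt_atTop 0] with x h1 h2 h3 hx
    refine lt_of_le_of_lt ?_ h1
    refine div_le_div_of_nonneg_right ?_ h2.le
    obtain ⟨n, hn⟩ : ∃ n : ℕ+, (n : ℕ) = atomCount π x :=
      ⟨⟨atomCount π x, n₀.pos.trans_le h3⟩, rfl⟩
    have hge : 1 ≤ x * π.real {n} := (le_atomCount_iff π hanti hx.le n).1 hn.le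
    have h4 := hn₀ n (by rw [← PNat.coe_le_coe, hn]; exact h3)
    rw [← hn]
    by_contra h
    have h6 := le_increasingInverse hmono hζt (by positivity) (not_le.1 h)
    nlinarith [mul_le_mul_of_nonneg_left h6 (hpos n).le]

theorem tendsto_muFun_two_mul_div {γ : ℝ} (hγ : 0 < γ) (π : Measure ℕ+) [IsProbabilityMeasure π]
    (hpos : ∀ i : ℕ+, 0 < π.real {i}) (hanti : Antitone fun i : ℕ+ => π.real {i})
    (hreg : IsRegularDistribution γ π) (hμ : Tendsto (muFun π) atTop atTop) :
    Tendsto (fun t => muFun π (2 * t) / muFun π t) atTop (𝓝 (2 ^ γ)) := by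
  obtain ⟨ζ, hζ, hπζ⟩ := hreg
  have hN := tendsto_atomCount_div hγ π hpos hanti hζ hπζ
  have hζt := hζ.tendsto_atTop hγ
  have h2t : Tendsto (fun x : ℝ => 2 * x) atTop atTop := tendsto_id.const_mul_atTop two_pos
  have hNt := (tendsto_atomCount_atTop π hpos hanti).eventually_gt_atTop 0
  refine tendsto_muFun_ratio π (by positivity) two_pos ?_ hNt hμ
  have h := ((hN.comp h2t).mul (hζ.tendsto_ratio 2 two_pos)).div hN one_ne_zero
  rw [one_mul, div_one] at h
  refine h.congr' ?_
  filter_upwards [hζt.eventually_gt_atTop 0, h2t.eventually (hζt.eventually_gt_atTop 0), hNt]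
    with x h1 h2 h3
  simp only [Function.comp, Pi.div_apply]
  have h3' : (atomCount π x : ℝ) ≠ 0 := by exact_mod_cast h3.ne'
  have := h1.ne'
  have := h2.ne'
  field_simp

/-! ### Poisson weights -/

/-- The probability that a Poisson variable of mean `t` equals `m`. -/
noncomputable def poissonWeight (t : ℝ) (m : ℕ) : ℝ := Real.exp (-t) * (t ^ m / m.factorial)

theorem poissonWeight_nonneg {t : ℝ} (ht : 0 ≤ t) (m : ℕ) : 0 ≤ poissonWeight t m := by
  unfold poissonWeight; positivity

theorem hasSum_poissonWeight_mul_pow (t x : ℝ) :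
    HasSum (fun m => poissonWeight t m * x ^ m) (Real.exp (t * (x - 1))) := by
  have h := (NormedSpace.expSeries_div_hasSum_exp (t * x)).mul_left (Real.exp (-t))
  rw [← Real.exp_eq_exp_ℝ, ← Real.exp_add] at h
  convert! h using 1
  · ext m
    rw [poissonWeight, mul_pow]
    ring
  · ring_nf

theorem hasSum_poissonWeight (t : ℝ) : HasSum (poissonWeight t) 1 := by
  simpa using hasSum_poissonWeight_mul_pow t 1

theorem summable_poissonWeight_mul_of_le {t : ℝ} (ht : 0 ≤ t) {f : ℕ → ℝ} (hf : ∀ m, 0 ≤ f m)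
    {x : ℝ} (hx : ∀ m, f m ≤ x ^ m) : Summable fun m => poissonWeight t m * f m :=
  Summable.of_nonneg_of_le (fun m => mul_nonneg (poissonWeight_nonneg ht m) (hf m))
    (fun m => mul_le_mul_of_nonneg_left (hx m) (poissonWeight_nonneg ht m))
    (hasSum_poissonWeight_mul_pow t x).summable

theorem exp_neg_le_one_sub_add_sq {s : ℝ} (hs : |s| ≤ 1) : Real.exp (-s) ≤ 1 - s + s ^ 2 := by
  have h2 := (abs_le.1 (Real.abs_exp_sub_one_sub_id_le (x := -s) (by rwa [abs_neg]))).2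
  nlinarith

-- A Chernoff bound. The tilt `s = η / 2` carries the sign of `η`, so one computation covers both
-- tails; the exponent is `n (-η²/4 + η³/4)` up to higher-order terms already bounded, and `η ≤ 1/2`
-- gives `-n η²/8`.
open Classical in
theorem tsum_poissonWeight_bad_le {η : ℝ} (hη : |η| ≤ 1 / 2) (n : ℕ) :
    ∑' m : ℕ, poissonWeight ((1 + η) * n) m * (if η * ((m : ℝ) - n) < 0 then 1 else 0)
      ≤ Real.exp (-(n * η ^ 2 / 8)) := by
  have hη' := abs_le.1 hη
  set t := (1 + η) * (n : ℝ) with ht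
  have ht0 : 0 ≤ t := mul_nonneg (by linarith) (Nat.cast_nonneg n)
  set s := η / 2 with hs
  have h := (hasSum_poissonWeight_mul_pow t (Real.exp (-s))).mul_left (Real.exp (s * n))
  have hle : ∀ m : ℕ, poissonWeight t m * (if η * ((m : ℝ) - n) < 0 then 1 else 0)
      ≤ Real.exp (s * n) * (poissonWeight t m * Real.exp (-s) ^ m) := by
    intro m
    rw [mul_left_comm]
    refine mul_le_mul_of_nonneg_left ?_ (poissonWeight_nonneg ht0 m)
    rw [← Real.exp_nat_mul, ← Real.exp_add]
    split_ifs with hm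
    · rw [← Real.exp_zero]
      exact Real.exp_le_exp.2 (by rw [hs]; nlinarith)
    · exact (Real.exp_pos _).le
  have hsum : Summable fun m : ℕ => poissonWeight t m * (if η * ((m : ℝ) - n) < 0 then 1 else 0) :=
    summable_poissonWeight_mul_of_le ht0 (x := 1) (fun m => by split_ifs <;> simp)
      (fun m => by split_ifs <;> simp)
  refine (hsum.tsum_le_tsum hle h.summable).trans ?_
  rw [h.tsum_eq, ← Real.exp_add]
  refine Real.exp_le_exp.2 ?_
  have h1 := exp_neg_le_one_sub_add_sq (s := s) (by rw [hs, abs_div, abs_two]; linarith)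
  have h2 : t * (Real.exp (-s) - 1) ≤ t * (-s + s ^ 2) := mul_le_mul_of_nonneg_left (by linarith) ht0
  have h3 : (n : ℝ) * (s + (1 + η) * (-s + s ^ 2)) ≤ n * (-(η ^ 2 / 8)) := by
    refine mul_le_mul_of_nonneg_left ?_ (Nat.cast_nonneg n)
    rw [hs]
    nlinarith [mul_nonneg (sq_nonneg η) (sub_nonneg.2 hη'.2)]
  rw [ht] at h2 ⊢
  linarith

/-! ### Moment generating functions of the range and Poissonization -/

/-- The number of distinct values in `S` among the first `m` samples. -/
def rangeCountIn {Ω : Type*} (ξ : ℕ → Ω → ℕ+) (S : Finset ℕ+) (m : ℕ) (ω : Ω) : ℕ :=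
  (S ∩ (Finset.range m).image (fun k => ξ k ω)).card

theorem rangeCount_le {Ω : Type*} (ξ : ℕ → Ω → ℕ+) (m : ℕ) (ω : Ω) : rangeCount ξ m ω ≤ m :=
  Finset.card_image_le.trans (Finset.card_range m).le

theorem rangeCountIn_le {Ω : Type*} (ξ : ℕ → Ω → ℕ+) (S : Finset ℕ+) (m : ℕ) (ω : Ω) :
    rangeCountIn ξ S m ω ≤ m :=
  (Finset.card_le_card Finset.inter_subset_right).trans (rangeCount_le ξ m ω)

theorem rangeCount_mono {Ω : Type*} (ξ : ℕ → Ω → ℕ+) (ω : Ω) : Monotone fun m => rangeCount ξ m ω :=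
  fun _ _ h => Finset.card_le_card (Finset.image_subset_image (Finset.range_mono h))

/-- Each `i ∈ S` contributes `e^θ` if seen and `1` if not, that is `(1 - e^θ) 1{i unseen} + e^θ`.
Expanding the product leaves only events "all of `T` is avoided", whose probabilities are explicit.
-/
theorem exp_mul_rangeCountIn {Ω : Type*} (ξ : ℕ → Ω → ℕ+) (S : Finset ℕ+) (m : ℕ) (θ : ℝ) (ω : Ω) :
    Real.exp (θ * rangeCountIn ξ S m ω)
      = ∑ T ∈ S.powerset, (1 - Real.exp θ) ^ T.card * Real.exp θ ^ (S \ T).card *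
          (⋂ k ∈ Finset.range m, ξ k ⁻¹' (T : Set ℕ+)ᶜ).indicator 1 ω := by
  classical
  set I := (Finset.range m).image fun k => ξ k ω with hI
  have h1 : Real.exp (θ * rangeCountIn ξ S m ω)
      = ∏ i ∈ S, ((1 - Real.exp θ) * (if i ∈ I then 0 else 1) + Real.exp θ) := by
    rw [mul_comm, Real.exp_nat_mul, rangeCountIn, ← hI, ← Finset.prod_const,
      ← Finset.prod_ite_mem]
    refine Finset.prod_congr rfl fun i _ => ?_
    split_ifs <;> simp
  rw [h1, Finset.prod_add]
  refine Finset.sum_congr rfl fun T _ => ?_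
  rw [Finset.prod_mul_distrib, Finset.prod_const, Finset.prod_const, mul_right_comm]
  congr 1
  by_cases hω : ω ∈ ⋂ k ∈ Finset.range m, ξ k ⁻¹' (T : Set ℕ+)ᶜ
  · rw [Set.indicator_of_mem hω]
    refine Finset.prod_eq_one fun i hi => if_neg fun hiI => ?_
    obtain ⟨k, hk, rfl⟩ := Finset.mem_image.1 hiI
    exact Set.mem_iInter₂.1 hω k hk hi
  · rw [Set.indicator_of_notMem hω]
    simp only [Set.mem_iInter, not_forall] at hω
    obtain ⟨k, hk, hkT⟩ := hω
    have hkT' : ξ k ω ∈ T := by simpa using hkT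
    exact Finset.prod_eq_zero hkT' (if_pos (Finset.mem_image_of_mem _ hk))

section Range

variable {Ω : Type*} [MeasurableSpace Ω] {P : Measure Ω} {ξ : ℕ → Ω → ℕ+}

theorem measurable_image_range (hξ : ∀ k, Measurable (ξ k)) (m : ℕ) {β : Type*} [MeasurableSpace β]
    (f : Finset ℕ+ → β) : Measurable fun ω => f ((Finset.range m).image fun k => ξ k ω) := by
  have h1 : Measurable fun ω (k : Fin m) => ξ k ω := measurable_pi_lambda _ fun k => hξ k
  have h2 : Measurable fun x : Fin m → ℕ+ => f (Finset.univ.image x) := measurable_of_countable _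
  have h3 : (fun ω => f ((Finset.range m).image fun k => ξ k ω))
      = (fun x : Fin m → ℕ+ => f (Finset.univ.image x)) ∘ fun ω (k : Fin m) => ξ k ω := by
    ext1 ω
    simp only [Function.comp]
    congr 1
    ext i
    simp only [Finset.mem_image, Finset.mem_range, Finset.mem_univ, true_and]
    exact ⟨fun ⟨k, hk, h⟩ => ⟨⟨k, hk⟩, h⟩, fun ⟨k, h⟩ => ⟨k, k.2, h⟩⟩
  rw [h3]
  exact h2.comp h1

theorem measurable_rangeCount (hξ : ∀ k, Measurable (ξ k)) (m : ℕ) :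
    Measurable fun ω => (rangeCount ξ m ω : ℝ) :=
  measurable_image_range hξ m fun s => (s.card : ℝ)

theorem exp_mul_natCast_le {j m : ℕ} (h : j ≤ m) (θ : ℝ) :
    Real.exp (θ * j) ≤ Real.exp |θ| ^ m := by
  rw [← Real.exp_nat_mul, mul_comm]
  refine Real.exp_le_exp.2 ?_
  have h1 : (j : ℝ) ≤ m := by exact_mod_cast h
  nlinarith [le_abs_self θ, abs_nonneg θ, (Nat.cast_nonneg j : (0 : ℝ) ≤ j)]

theorem integrable_exp_rangeCount [IsFiniteMeasure P] (hξ : ∀ k, Measurable (ξ k)) (m : ℕ) (θ : ℝ) :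
    Integrable (fun ω => Real.exp (θ * rangeCount ξ m ω)) P :=
  Integrable.of_bound ((measurable_rangeCount hξ m).const_mul θ).exp.aestronglyMeasurable
    (Real.exp |θ| ^ m) (Eventually.of_forall fun ω => by
      rw [Real.norm_of_nonneg (Real.exp_pos _).le]
      exact exp_mul_natCast_le (rangeCount_le ξ m ω) θ)

theorem measureReal_avoid [IsProbabilityMeasure P] {π : Measure ℕ+} [IsProbabilityMeasure π]
    (hξ : ∀ k, Measurable (ξ k)) (hlaw : ∀ k, P.map (ξ k) = π) (hindep : iIndepFun ξ P)
    (T : Finset ℕ+) (m : ℕ) :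
    P.real (⋂ k ∈ Finset.range m, ξ k ⁻¹' (T : Set ℕ+)ᶜ) = (1 - ∑ i ∈ T, π.real {i}) ^ m := by
  have hT : MeasurableSet (T : Set ℕ+)ᶜ := MeasurableSet.of_discrete
  rw [Measure.real, hindep.measure_inter_preimage_eq_mul _ fun _ _ => hT, ENNReal.toReal_prod]
  have h1 : ∀ k ∈ Finset.range m, (P (ξ k ⁻¹' (T : Set ℕ+)ᶜ)).toReal = 1 - ∑ i ∈ T, π.real {i} := by
    intro k _
    rw [← Measure.map_apply (hξ k) hT, hlaw k, ← Measure.real,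
      probReal_compl_eq_one_sub MeasurableSet.of_discrete]
    congr 1
    exact (sum_measureReal_singleton T).symm
  rw [Finset.prod_congr rfl h1, Finset.prod_const, Finset.card_range]

theorem integral_exp_rangeCountIn [IsProbabilityMeasure P] {π : Measure ℕ+} [IsProbabilityMeasure π]
    (hξ : ∀ k, Measurable (ξ k)) (hlaw : ∀ k, P.map (ξ k) = π) (hindep : iIndepFun ξ P)
    (S : Finset ℕ+) (m : ℕ) (θ : ℝ) :
    ∫ ω, Real.exp (θ * rangeCountIn ξ S m ω) ∂P
      = ∑ T ∈ S.powerset, (1 - Real.exp θ) ^ T.card * Real.exp θ ^ (S \ T).card *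
          (1 - ∑ i ∈ T, π.real {i}) ^ m := by
  simp_rw [exp_mul_rangeCountIn]
  have hms : ∀ T : Finset ℕ+, MeasurableSet (⋂ k ∈ Finset.range m, ξ k ⁻¹' (T : Set ℕ+)ᶜ) :=
    fun T => Finset.measurableSet_biInter _ fun k _ => hξ k MeasurableSet.of_discrete
  rw [integral_finsetSum]
  · refine Finset.sum_congr rfl fun T _ => ?_
    rw [integral_const_mul, integral_indicator_one (hms T), measureReal_avoid hξ hlaw hindep]
  · intro T _
    exact ((integrable_const (1 : ℝ)).indicator (hms T)).const_mul _

/-- Poisson averaging turns `(1 - π(T))^m` into `exp (-t π(T))`, which is multiplicative over `T`,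
so the expansion over subsets folds back into a product. -/
theorem hasSum_poissonWeight_mul_integral_exp [IsProbabilityMeasure P] {π : Measure ℕ+}
    [IsProbabilityMeasure π] (hξ : ∀ k, Measurable (ξ k)) (hlaw : ∀ k, P.map (ξ k) = π)
    (hindep : iIndepFun ξ P) (S : Finset ℕ+) (t θ : ℝ) :
    HasSum (fun m => poissonWeight t m * ∫ ω, Real.exp (θ * rangeCountIn ξ S m ω) ∂P)
      (∏ i ∈ S, (1 + (Real.exp θ - 1) * (1 - Real.exp (-t * π.real {i})))) := by
  classical
  simp_rw [integral_exp_rangeCountIn hξ hlaw hindep, Finset.mul_sum]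
  have h1 : ∏ i ∈ S, (1 + (Real.exp θ - 1) * (1 - Real.exp (-t * π.real {i})))
      = ∑ T ∈ S.powerset, (1 - Real.exp θ) ^ T.card * Real.exp θ ^ (S \ T).card *
          Real.exp (t * ((1 - ∑ i ∈ T, π.real {i}) - 1)) := by
    rw [Finset.prod_congr rfl (g := fun i => (1 - Real.exp θ) * Real.exp (-t * π.real {i})
      + Real.exp θ) (fun i _ => by ring), Finset.prod_add]
    refine Finset.sum_congr rfl fun T _ => ?_
    rw [Finset.prod_mul_distrib, Finset.prod_const, Finset.prod_const, ← Real.exp_sum,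
      ← Finset.mul_sum]
    ring_nf
  rw [h1]
  refine hasSum_sum fun T _ => ?_
  convert! (hasSum_poissonWeight_mul_pow t (1 - ∑ i ∈ T, π.real {i})).mul_left
    ((1 - Real.exp θ) ^ T.card * Real.exp θ ^ (S \ T).card) using 2
  ring

/-- The moment generating function of the range at an independent Poisson time of mean `t`. -/
noncomputable def poissonizedMgf (P : Measure Ω) (ξ : ℕ → Ω → ℕ+) (t θ : ℝ) : ℝ :=
  ∑' m, poissonWeight t m * mgf (fun ω => (rangeCount ξ m ω : ℝ)) P θ

theorem mgf_rangeCount_le [IsProbabilityMeasure P] (hξ : ∀ k, Measurable (ξ k)) (m : ℕ) (θ : ℝ) :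
    mgf (fun ω => (rangeCount ξ m ω : ℝ)) P θ ≤ Real.exp |θ| ^ m := by
  have h := integral_mono (integrable_exp_rangeCount (P := P) hξ m θ)
    (integrable_const (Real.exp |θ| ^ m)) fun ω => exp_mul_natCast_le (rangeCount_le ξ m ω) θ
  simpa [mgf] using h

theorem hasSum_poissonizedMgf [IsProbabilityMeasure P] (hξ : ∀ k, Measurable (ξ k)) {t : ℝ}
    (ht : 0 ≤ t) (θ : ℝ) :
    HasSum (fun m => poissonWeight t m * mgf (fun ω => (rangeCount ξ m ω : ℝ)) P θ)
      (poissonizedMgf P ξ t θ) :=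
  (summable_poissonWeight_mul_of_le ht (fun _ => mgf_nonneg) fun m => mgf_rangeCount_le hξ m θ).hasSum

theorem one_add_mul_one_sub_exp_neg_pos (θ : ℝ) {a : ℝ} (ha : 0 ≤ 1 - Real.exp a) :
    0 < 1 + (Real.exp θ - 1) * (1 - Real.exp a) := by
  nlinarith [Real.exp_pos θ, Real.exp_pos a, mul_nonneg (Real.exp_pos θ).le ha]

theorem summable_log_poissonized (π : Measure ℕ+) [IsProbabilityMeasure π] {t : ℝ} (ht : 0 ≤ t)
    (θ : ℝ) :
    Summable fun i : ℕ+ => Real.log (1 + (Real.exp θ - 1) * (1 - Real.exp (-t * π.real {i}))) :=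
  Real.summable_log_one_add_of_summable ((summable_muFun π ht).mul_left _)

/-- Let `S` exhaust `ℕ+` in the finite product formula. For each `ω` the restricted count is exact
once `S` contains the values seen; `e^{|θ| m}` dominates both the expectation and, against the
Poisson weights, the sum over `m`. -/
theorem poissonizedMgf_eq_exp_tsum [IsProbabilityMeasure P] {π : Measure ℕ+}
    [IsProbabilityMeasure π] (hξ : ∀ k, Measurable (ξ k)) (hlaw : ∀ k, P.map (ξ k) = π)
    (hindep : iIndepFun ξ P) {t : ℝ} (ht : 0 ≤ t) (θ : ℝ) :
    poissonizedMgf P ξ t θ = Real.exp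
      (∑' i : ℕ+, Real.log (1 + (Real.exp θ - 1) * (1 - Real.exp (-t * π.real {i})))) := by
  have h1 : Tendsto (fun S : Finset ℕ+ =>
      ∏ i ∈ S, (1 + (Real.exp θ - 1) * (1 - Real.exp (-t * π.real {i})))) atTop
      (𝓝 (Real.exp (∑' i : ℕ+,
        Real.log (1 + (Real.exp θ - 1) * (1 - Real.exp (-t * π.real {i})))))) := by
    refine ((Real.continuous_exp.tendsto _).comp
      (summable_log_poissonized π ht θ).hasSum).congr fun S => ?_
    simp only [Function.comp, Real.exp_sum]
    refine Finset.prod_congr rfl fun i _ => Real.exp_log (one_add_mul_one_sub_exp_neg_pos θ ?_)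
    exact one_sub_exp_neg_nonneg ht measureReal_nonneg
  refine tendsto_nhds_unique ?_ h1
  simp_rw [fun S => ((hasSum_poissonWeight_mul_integral_exp hξ hlaw hindep S t θ).tsum_eq).symm]
  have hmeas : ∀ (S : Finset ℕ+) m, Measurable fun ω => Real.exp (θ * rangeCountIn ξ S m ω) :=
    fun S m => measurable_image_range hξ m fun s => Real.exp (θ * ((S ∩ s).card : ℕ))
  have hbound : ∀ (S : Finset ℕ+) m ω,
      ‖Real.exp (θ * rangeCountIn ξ S m ω)‖ ≤ Real.exp |θ| ^ m := by
    intro S m ω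
    rw [Real.norm_of_nonneg (Real.exp_pos _).le]
    exact exp_mul_natCast_le (rangeCountIn_le ξ S m ω) θ
  refine tendsto_tsum_of_dominated_convergence
    (bound := fun m => poissonWeight t m * Real.exp |θ| ^ m)
    (hasSum_poissonWeight_mul_pow t _).summable (fun m => ?_) (Eventually.of_forall fun S m => ?_)
  · refine Tendsto.const_mul _ ?_
    refine tendsto_integral_filter_of_dominated_convergence (fun _ => Real.exp |θ| ^ m)
      (Eventually.of_forall fun S => (hmeas S m).aestronglyMeasurable)
      (Eventually.of_forall fun S => Eventually.of_forall (hbound S m)) (integrable_const _)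
      (Eventually.of_forall fun ω => ?_)
    refine tendsto_const_nhds.congr' ?_
    filter_upwards [eventually_ge_atTop ((Finset.range m).image fun k => ξ k ω)] with S hS
    rw [rangeCountIn, Finset.inter_eq_right.2 hS, rangeCount]
  · rw [norm_mul, Real.norm_of_nonneg (poissonWeight_nonneg ht m)]
    refine mul_le_mul_of_nonneg_left ?_ (poissonWeight_nonneg ht m)
    refine (norm_integral_le_of_norm_le_const (Eventually.of_forall (hbound S m))).trans ?_
    simp

/-! ### Comparison of the range with its Poissonized version -/

theorem mgf_rangeCount_le_of_mul_nonneg [IsFiniteMeasure P] (hξ : ∀ k, Measurable (ξ k)) {θ : ℝ}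
    {m n : ℕ} (h : 0 ≤ θ * ((n : ℝ) - m)) :
    mgf (fun ω => (rangeCount ξ m ω : ℝ)) P θ ≤ mgf (fun ω => (rangeCount ξ n ω : ℝ)) P θ := by
  refine integral_mono (integrable_exp_rangeCount hξ m θ) (integrable_exp_rangeCount hξ n θ)
    fun ω => Real.exp_le_exp.2 ?_
  rcases lt_trichotomy m n with hmn | rfl | hmn
  · have h1 : (rangeCount ξ m ω : ℝ) ≤ rangeCount ξ n ω := by
      exact_mod_cast rangeCount_mono ξ ω hmn.le
    have h2 : (m : ℝ) < n := by exact_mod_cast hmn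
    exact mul_le_mul_of_nonneg_left h1 (nonneg_of_mul_nonneg_left h (by linarith))
  · exact le_rfl
  · have h1 : (rangeCount ξ n ω : ℝ) ≤ rangeCount ξ m ω := by
      exact_mod_cast rangeCount_mono ξ ω hmn.le
    have h2 : (n : ℝ) < m := by exact_mod_cast hmn
    have h3 : θ ≤ 0 := by
      by_contra h4
      nlinarith [not_le.1 h4]
    exact mul_le_mul_of_nonpos_left h1 h3

/-- When time is shifted in the direction of `θ`, every `m` on the side of `n` chosen by `η` has a
moment generating function at least that of `n`; the other `m` are dropped. -/
theorem mgf_rangeCount_mul_le_poissonizedMgf [IsProbabilityMeasure P] (hξ : ∀ k, Measurable (ξ k))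
    {η θ : ℝ} (hη : |η| ≤ 1 / 2) (hη0 : η ≠ 0) (hθη : 0 ≤ θ * η) (n : ℕ) :
    mgf (fun ω => (rangeCount ξ n ω : ℝ)) P θ * (1 - Real.exp (-(n * η ^ 2 / 8)))
      ≤ poissonizedMgf P ξ ((1 + η) * n) θ := by
  classical
  have ht : 0 ≤ (1 + η) * (n : ℝ) :=
    mul_nonneg (by linarith [(abs_le.1 hη).1]) (Nat.cast_nonneg n)
  set L := mgf (fun ω => (rangeCount ξ n ω : ℝ)) P θ with hL
  have hL0 : 0 ≤ L := mgf_nonneg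
  have hbad : Summable fun m : ℕ => poissonWeight ((1 + η) * n) m *
      (if η * ((m : ℝ) - n) < 0 then 1 else 0) :=
    summable_poissonWeight_mul_of_le ht (x := 1) (fun m => by split_ifs <;> simp)
      (fun m => by split_ifs <;> simp)
  have h1 := ((hasSum_poissonWeight ((1 + η) * n)).sub hbad.hasSum).mul_left L
  have h2 := hasSum_le (fun m => ?_) h1 (hasSum_poissonizedMgf (P := P) hξ ht θ)
  · refine le_trans (mul_le_mul_of_nonneg_left ?_ hL0) h2
    linarith [tsum_poissonWeight_bad_le hη n]
  · have hw := poissonWeight_nonneg ht m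
    split_ifs with hm
    · rw [mul_one, sub_self, mul_zero]
      exact mul_nonneg hw mgf_nonneg
    · rw [mul_zero, sub_zero, mul_comm]
      refine mul_le_mul_of_nonneg_left (mgf_rangeCount_le_of_mul_nonneg hξ ?_) hw
      have h3 := mul_nonneg hθη (not_lt.1 hm)
      have h4 : 0 < η ^ 2 := by positivity
      refine nonneg_of_mul_nonneg_right (b := θ * ((m : ℝ) - n)) ?_ h4
      linarith

/-- Shifting against `θ` reverses the comparison, but the wrong side can no longer be dropped. There
`x ≤ a/2 + x²/(2a)` with `x = e^{θ R}` trades it for a small probability and the transform at `2θ`;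
`a` is left free for balancing. -/
theorem poissonizedMgf_le [IsProbabilityMeasure P] (hξ : ∀ k, Measurable (ξ k))
    {η θ : ℝ} (hη : |η| ≤ 1 / 2) (hη0 : η ≠ 0) (hθη : θ * η ≤ 0) (n : ℕ) {a : ℝ} (ha : 0 < a) :
    poissonizedMgf P ξ ((1 + η) * n) θ ≤ mgf (fun ω => (rangeCount ξ n ω : ℝ)) P θ
      + a / 2 * Real.exp (-(n * η ^ 2 / 8)) + poissonizedMgf P ξ ((1 + η) * n) (2 * θ) / (2 * a) := by
  classical
  have ht : 0 ≤ (1 + η) * (n : ℝ) :=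
    mul_nonneg (by linarith [(abs_le.1 hη).1]) (Nat.cast_nonneg n)
  set L := mgf (fun ω => (rangeCount ξ n ω : ℝ)) P θ with hL
  have hL0 : 0 ≤ L := mgf_nonneg
  have hbad : Summable fun m : ℕ => poissonWeight ((1 + η) * n) m *
      (if η * ((m : ℝ) - n) < 0 then 1 else 0) :=
    summable_poissonWeight_mul_of_le ht (x := 1) (fun m => by split_ifs <;> simp)
      (fun m => by split_ifs <;> simp)
  have h1 := (((hasSum_poissonWeight ((1 + η) * n)).mul_left L).add
    (hbad.hasSum.mul_left (a / 2))).add ((hasSum_poissonizedMgf (P := P) hξ ht (2 * θ)).div_const (2 * a))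
  have h2 := hasSum_le (fun m => ?_) (hasSum_poissonizedMgf (P := P) hξ ht θ) h1
  · have := mul_le_mul_of_nonneg_left (tsum_poissonWeight_bad_le hη n) (by positivity : 0 ≤ a / 2)
    linarith
  · have hw := poissonWeight_nonneg ht m
    have hM : 0 ≤ mgf (fun ω => (rangeCount ξ m ω : ℝ)) P (2 * θ) := mgf_nonneg
    split_ifs with hm
    · have h3 : mgf (fun ω => (rangeCount ξ m ω : ℝ)) P θ
          ≤ a / 2 + mgf (fun ω => (rangeCount ξ m ω : ℝ)) P (2 * θ) / (2 * a) := by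
        have h4 := integral_mono (integrable_exp_rangeCount (P := P) hξ m θ)
          (g := fun ω => a / 2 + Real.exp (2 * θ * rangeCount ξ m ω) / (2 * a))
          ((integrable_const _).add ((integrable_exp_rangeCount hξ m _).div_const _)) fun ω => ?_
        · rw [integral_add (integrable_const _) ((integrable_exp_rangeCount hξ m _).div_const _),
            integral_const, integral_div] at h4
          simpa [mgf] using h4
        · have h5 : Real.exp (2 * θ * rangeCount ξ m ω) = Real.exp (θ * rangeCount ξ m ω) ^ 2 := by
            rw [← Real.exp_nat_mul]; push_cast; ring_nf
          simp only [h5]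
          rw [div_add_div _ _ two_ne_zero (by positivity), le_div_iff₀ (by positivity)]
          nlinarith [sq_nonneg (Real.exp (θ * rangeCount ξ m ω) - a)]
      calc _ ≤ _ := mul_le_mul_of_nonneg_left h3 hw
        _ = a / 2 * (poissonWeight ((1 + η) * n) m * 1) + poissonWeight ((1 + η) * n) m *
            mgf (fun ω => (rangeCount ξ m ω : ℝ)) P (2 * θ) / (2 * a) := by ring
        _ ≤ _ := by linarith [mul_nonneg hL0 hw]
    · have h3 : mgf (fun ω => (rangeCount ξ m ω : ℝ)) P θ ≤ L := by
        refine mgf_rangeCount_le_of_mul_nonneg hξ ?_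
        have h3 := mul_nonneg (neg_nonneg.2 hθη) (not_lt.1 hm)
        have h4 : 0 < η ^ 2 := by positivity
        refine nonneg_of_mul_nonneg_right (b := θ * ((n : ℝ) - m)) ?_ h4
        linarith
      have h4 := mul_le_mul_of_nonneg_left h3 hw
      have h5 : 0 ≤ poissonWeight ((1 + η) * n) m *
            mgf (fun ω => (rangeCount ξ m ω : ℝ)) P (2 * θ) / (2 * a) := by positivity
      simp only [mul_zero, add_zero]
      linarith

end Range

/-! ### Gärtner–Ellis theorem with a quadratic limit -/

theorem eventually_mgf_le_of_tendsto_cgf {Ω : Type*} [MeasurableSpace Ω] {P : Measure Ω}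
    [IsProbabilityMeasure P] {Z : ℕ → Ω → ℝ} {b : ℕ → ℝ} (hb : Tendsto b atTop atTop)
    (hexp : ∀ n (u : ℝ), Integrable (fun ω => Real.exp (u * Z n ω)) P) {u c c' : ℝ}
    (hlim : Tendsto (fun n => cgf (Z n) P (b n * u) / b n) atTop (𝓝 c)) (hc : c < c') :
    ∀ᶠ n in atTop, mgf (Z n) P (b n * u) ≤ Real.exp (b n * c') := by
  filter_upwards [hlim.eventually (gt_mem_nhds hc), hb.eventually_gt_atTop 0] with n h1 h2
  rw [div_lt_iff₀ h2, cgf, mul_comm c'] at h1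
  exact (Real.log_le_iff_le_exp (mgf_pos (hexp n _))).1 h1.le

theorem eventually_le_mgf_of_tendsto_cgf {Ω : Type*} [MeasurableSpace Ω] {P : Measure Ω}
    [IsProbabilityMeasure P] {Z : ℕ → Ω → ℝ} {b : ℕ → ℝ} (hb : Tendsto b atTop atTop)
    (hexp : ∀ n (u : ℝ), Integrable (fun ω => Real.exp (u * Z n ω)) P) {u c c' : ℝ}
    (hlim : Tendsto (fun n => cgf (Z n) P (b n * u) / b n) atTop (𝓝 c)) (hc : c' < c) :
    ∀ᶠ n in atTop, Real.exp (b n * c') ≤ mgf (Z n) P (b n * u) := by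
  filter_upwards [hlim.eventually (lt_mem_nhds hc), hb.eventually_gt_atTop 0] with n h1 h2
  rw [lt_div_iff₀ h2, cgf, mul_comm c'] at h1
  exact (Real.le_log_iff_exp_le (mgf_pos (hexp n _))).1 h1.le

theorem setIntegral_exp_mul_le_mgf {Ω : Type*} [MeasurableSpace Ω] {P : Measure Ω}
    {X : Ω → ℝ} (hX : Measurable X) (hexp : ∀ u : ℝ, Integrable (fun ω => Real.exp (u * X ω)) P)
    {A : Set ℝ} (hA : MeasurableSet A) {β : ℝ} (hβ : 0 ≤ β) (u : ℝ) {v c : ℝ}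
    (hc : ∀ x ∈ A, c ≤ v * x) :
    ∫ ω in X ⁻¹' A, Real.exp (β * u * X ω) ∂P ≤ Real.exp (-(β * c)) * mgf X P (β * (u + v)) := by
  rw [mgf, ← integral_const_mul]
  refine le_trans ?_ (setIntegral_le_integral (s := X ⁻¹' A) ((hexp _).const_mul _)
    (Eventually.of_forall fun ω => by positivity))
  refine setIntegral_mono_on (hexp _).integrableOn ((hexp _).const_mul _).integrableOn
    (hX hA) fun ω hω => ?_
  rw [← Real.exp_add]
  refine Real.exp_le_exp.2 ?_
  have := mul_le_mul_of_nonneg_left (hc (X ω) hω) hβ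
  linarith

/-- An extra tilt `v` changes the exponent to `s (u + v)²/2 - s (u v + v²) = s u²/2 - s v²/2`. The
gain `s v²/2 ≥ 4 κ` pays for the error `κ`, the stated loss `κ`, and `2 κ` for the factor `1/4`. -/
theorem eventually_setIntegral_exp_le {Ω : Type*} [MeasurableSpace Ω] {P : Measure Ω}
    [IsProbabilityMeasure P] {Z : ℕ → Ω → ℝ} (hZ : ∀ n, Measurable (Z n)) {b : ℕ → ℝ}
    (hb : Tendsto b atTop atTop) {s : ℝ}
    (hexp : ∀ n (u : ℝ), Integrable (fun ω => Real.exp (u * Z n ω)) P)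
    (hlim : ∀ u : ℝ, Tendsto (fun n => cgf (Z n) P (b n * u) / b n) atTop (𝓝 (s * u ^ 2 / 2)))
    {A : Set ℝ} (hA : MeasurableSet A) {u v κ : ℝ} (hκ : 0 < κ) (hκv : 8 * κ ≤ s * v ^ 2)
    (hv : ∀ x ∈ A, s * (u * v + v ^ 2) ≤ v * x) :
    ∀ᶠ n in atTop, ∫ ω in Z n ⁻¹' A, Real.exp (b n * u * Z n ω) ∂P
      ≤ Real.exp (b n * (s * u ^ 2 / 2 - κ)) * (1 / 4) := by
  filter_upwards [eventually_mgf_le_of_tendsto_cgf hb hexp (hlim (u + v))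
    (lt_add_of_pos_right _ hκ), hb.eventually_gt_atTop 0, hb.eventually_ge_atTop (2 / κ)]
    with n h2 hbn hbn2
  have h4 := setIntegral_exp_mul_le_mgf (hZ n) (hexp n) hA hbn.le u hv
  have hquart : Real.exp (-(b n * (2 * κ))) ≤ 1 / 4 := by
    have h6 : 4 ≤ b n * (2 * κ) := by
      rw [div_le_iff₀ hκ] at hbn2; linarith
    have h7 := Real.add_one_le_exp (b n * (2 * κ))
    rw [Real.exp_neg, ← one_div]
    exact one_div_le_one_div_of_le (by norm_num) (by linarith)
  refine h4.trans ((mul_le_mul_of_nonneg_left h2 (Real.exp_pos _).le).trans ?_)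
  refine le_trans ?_ (mul_le_mul_of_nonneg_left hquart (Real.exp_pos _).le)
  rw [← Real.exp_add, ← Real.exp_add]
  refine Real.exp_le_exp.2 ?_
  have h5 := mul_nonneg hbn.le (sub_nonneg.2 hκv)
  linarith

/-- Cramér's change of measure without normalizing the tilted measure: the two half-lines outside
the ball carry at most a quarter of `E` each, so the ball carries at least `E / 2`, and on it the
density is nearly constant. -/
theorem eventually_exp_le_measureReal_ball {Ω : Type*} [MeasurableSpace Ω] {P : Measure Ω}
    [IsProbabilityMeasure P] {Z : ℕ → Ω → ℝ} (hZ : ∀ n, Measurable (Z n)) {b : ℕ → ℝ}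
    (hb : Tendsto b atTop atTop) {s : ℝ} (hs : 0 < s)
    (hexp : ∀ n (u : ℝ), Integrable (fun ω => Real.exp (u * Z n ω)) P)
    (hlim : ∀ u : ℝ, Tendsto (fun n => cgf (Z n) P (b n * u) / b n) atTop (𝓝 (s * u ^ 2 / 2)))
    {x c δ : ℝ} (hδ : 0 < δ) (hc : c < -(x ^ 2 / (2 * s))) :
    ∀ᶠ n in atTop, Real.exp (b n * c) ≤ P.real (Z n ⁻¹' Metric.ball x δ) := by
  -- The saddle point: the derivative of `s u²/2` equals `x` there.
  set u := x / s with hu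
  have hx_eq : x = s * u := by rw [hu]; field_simp
  have hrate : x ^ 2 / (2 * s) = s * u ^ 2 / 2 := by rw [hx_eq]; field_simp
  rw [hrate] at hc
  obtain ⟨η, hη, hηc⟩ : ∃ η : ℝ, 0 < η ∧ c + η < -(s * u ^ 2 / 2) :=
    ⟨(-(s * u ^ 2 / 2) - c) / 2, by linarith, by linarith⟩
  -- a radius `r ≤ δ` with `|u| r ≤ η / 2`
  obtain ⟨r, hr, hrδ, hur⟩ : ∃ r : ℝ, 0 < r ∧ r ≤ δ ∧ |u| * r ≤ η / 2 := by
    refine ⟨min δ (η / (2 * (|u| + 1))), lt_min hδ (by positivity), min_le_left _ _, ?_⟩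
    have h1 : min δ (η / (2 * (|u| + 1))) ≤ η / (2 * (|u| + 1)) := min_le_right _ _
    have h2 := mul_le_mul_of_nonneg_left h1 (abs_nonneg u)
    refine h2.trans ?_
    rw [mul_div_assoc', div_le_div_iff₀ (by positivity) two_pos]
    nlinarith [abs_nonneg u]
  -- the tilt `v` used on the two sides of the ball
  set v := r / s with hv
  have hv0 : 0 < v := div_pos hr hs
  have hr_eq : r = s * v := by rw [hv]; field_simp
  obtain ⟨κ, hκ, hκη, hκv⟩ : ∃ κ : ℝ, 0 < κ ∧ κ ≤ η / 4 ∧ 8 * κ ≤ s * v ^ 2 := by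
    have : 0 < s * v ^ 2 := by positivity
    exact ⟨min (η / 4) (s * v ^ 2 / 8), lt_min (by positivity) (by positivity), min_le_left _ _,
      by have := min_le_right (η / 4) (s * v ^ 2 / 8); linarith⟩
  filter_upwards [eventually_le_mgf_of_tendsto_cgf hb hexp (hlim u) (sub_lt_self _ hκ),
    eventually_setIntegral_exp_le hZ hb hexp hlim (measurableSet_Ici (a := x + r)) (u := u)
      (v := v) hκ hκv
      (fun y hy => by
        have h := mul_le_mul_of_nonneg_left (show x + r ≤ y from hy) hv0.le
        rw [hx_eq, hr_eq] at h
        linarith),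
    eventually_setIntegral_exp_le hZ hb hexp hlim (measurableSet_Iic (a := x - r)) (u := u)
      (v := -v) hκ (by rwa [neg_sq])
      (fun y hy => by
        have h := mul_le_mul_of_nonneg_left (show y ≤ x - r from hy) hv0.le
        rw [hx_eq, hr_eq] at h
        linarith),
    hb.eventually_gt_atTop 0, hb.eventually_ge_atTop (2 / κ)] with n h1 h6 h7 hbn hbn2
  set E := Real.exp (b n * (s * u ^ 2 / 2 - κ)) with hE
  have hE0 : 0 < E := Real.exp_pos _
  have h8 : ∫ ω in Z n ⁻¹' Metric.ball x r, Real.exp (b n * u * Z n ω) ∂P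
      ≤ Real.exp (b n * (u * x + η / 2)) * P.real (Z n ⁻¹' Metric.ball x r) := by
    rw [mul_comm (Real.exp _), ← smul_eq_mul (P.real _), ← setIntegral_const]
    refine setIntegral_mono_on (hexp n _).integrableOn (integrable_const _).integrableOn
      (hZ n Metric.isOpen_ball.measurableSet) fun ω hω => Real.exp_le_exp.2 ?_
    have h9 : |Z n ω - x| < r := hω
    have h10 : u * (Z n ω - x) ≤ η / 2 :=
      (le_abs_self _).trans ((abs_mul _ _).le.trans
        ((mul_le_mul_of_nonneg_left h9.le (abs_nonneg u)).trans hur))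
    nlinarith
  have h9 : E ≤ ∫ ω in Z n ⁻¹' Metric.ball x r, Real.exp (b n * u * Z n ω) ∂P
      + E * (1 / 4) + E * (1 / 4) := by
    refine h1.trans ?_
    have hcompl : (Z n ⁻¹' Metric.ball x r)ᶜ
        = Z n ⁻¹' Set.Ici (x + r) ∪ Z n ⁻¹' Set.Iic (x - r) := by
      rw [← Set.preimage_compl, ← Set.preimage_union, Real.ball_eq_Ioo]
      congr 1
      ext y
      simp only [Set.mem_compl_iff, Set.mem_Ioo, not_and_or, not_lt, Set.mem_union, Set.mem_Ici,
        Set.mem_Iic]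
      exact or_comm
    rw [mgf, ← integral_add_compl (hZ n Metric.isOpen_ball.measurableSet) (hexp n (b n * u)), hcompl,
      setIntegral_union ?_ (hZ n measurableSet_Iic) (hexp n _).integrableOn (hexp n _).integrableOn]
    · linarith
    · refine Disjoint.preimage _ (Set.disjoint_left.2 fun y hy hy' => ?_)
      have h10 : x + r ≤ y := hy
      have h11 : y ≤ x - r := hy'
      linarith
  have h10 : Real.exp (b n * c) ≤ P.real (Z n ⁻¹' Metric.ball x r) := by
    have h11 : E / 2 ≤ Real.exp (b n * (u * x + η / 2)) * P.real (Z n ⁻¹' Metric.ball x r) := by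
      linarith
    have h12 : Real.exp (b n * (u * x + η / 2)) * Real.exp (b n * c) ≤ E / 2 := by
      have h13 : Real.exp (-(b n * κ)) ≤ 1 / 2 := by
        have h14 : 2 ≤ b n * κ := by
          rwa [div_le_iff₀ hκ] at hbn2
        have h15 := Real.add_one_le_exp (b n * κ)
        rw [Real.exp_neg, ← one_div]
        exact one_div_le_one_div_of_le (by norm_num) (by linarith)
      have h14 : Real.exp (b n * (u * x + η / 2)) * Real.exp (b n * c) ≤
          E * Real.exp (-(b n * κ)) := by
        rw [hE, ← Real.exp_add, ← Real.exp_add, hx_eq]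
        refine Real.exp_le_exp.2 ?_
        have h15 : u * (s * u) + η / 2 + c ≤ s * u ^ 2 / 2 - κ - κ := by nlinarith
        nlinarith
      nlinarith
    exact le_of_mul_le_mul_left (h12.trans h11) (Real.exp_pos _)
  exact h10.trans (measureReal_mono (Set.preimage_mono (Metric.ball_subset_ball hrδ)))

theorem eventually_measureReal_preimage_le_exp {Ω : Type*} [MeasurableSpace Ω] {P : Measure Ω}
    [IsProbabilityMeasure P] {Z : ℕ → Ω → ℝ} (hZ : ∀ n, Measurable (Z n)) {b : ℕ → ℝ}
    (hb : Tendsto b atTop atTop) {s : ℝ} (hs : 0 < s)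
    (hexp : ∀ n (u : ℝ), Integrable (fun ω => Real.exp (u * Z n ω)) P)
    (hlim : ∀ u : ℝ, Tendsto (fun n => cgf (Z n) P (b n * u) / b n) atTop (𝓝 (s * u ^ 2 / 2)))
    {Γ : Set ℝ} {c d : ℝ} (hd : ∀ x ∈ Γ, d < x ^ 2 / (2 * s)) (hdc : -d < c) :
    ∀ᶠ n in atTop, P.real (Z n ⁻¹' Γ) ≤ Real.exp (b n * c) := by
  -- `Γ` misses `(-r, r)`, so two half-line Chernoff bounds suffice. For negative `d` the root is
  -- `0` and the argument still applies.
  set r := √(2 * s * d) with hr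
  have hr2 : 2 * s * d ≤ r ^ 2 := by
    rcases le_total 0 (2 * s * d) with h | h
    · exact (Real.sq_sqrt h).ge
    · exact h.trans (sq_nonneg _)
  have habs : ∀ x ∈ Γ, r ≤ |x| := by
    intro x hx
    have h1 := hd x hx
    rw [lt_div_iff₀ (by positivity)] at h1
    rw [← Real.sqrt_sq_eq_abs]
    exact Real.sqrt_le_sqrt (by linarith)
  set v := r / s with hv
  have hr0 : 0 ≤ r := Real.sqrt_nonneg _
  have hv0 : 0 ≤ v := by positivity
  have hr_eq : r = s * v := by rw [hv]; field_simp
  obtain ⟨η, hη, hηc⟩ : ∃ η : ℝ, 0 < η ∧ -d + 2 * η ≤ c :=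
    ⟨(c + d) / 2, by linarith, by linarith⟩
  filter_upwards [eventually_mgf_le_of_tendsto_cgf hb hexp (hlim v)
    (lt_add_of_pos_right _ hη), eventually_mgf_le_of_tendsto_cgf hb hexp (hlim (-v))
    (lt_add_of_pos_right _ hη), hb.eventually_gt_atTop 0,
    hb.eventually_ge_atTop (1 / η)] with n h1 h2 hbn hbn2
  have h4 := setIntegral_exp_mul_le_mgf (hZ n) (hexp n) (A := Set.Ici r) measurableSet_Ici hbn.le 0
    (v := v) (c := v * r) (fun y hy => mul_le_mul_of_nonneg_left hy hv0)
  have h5 := setIntegral_exp_mul_le_mgf (hZ n) (hexp n) (A := Set.Iic (-r)) measurableSet_Iic hbn.le 0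
    (v := -v) (c := v * r) (fun y hy => by have : y ≤ -r := hy; nlinarith)
  have hP : ∀ A : Set ℝ, ∫ ω in Z n ⁻¹' A, Real.exp (b n * 0 * Z n ω) ∂P = P.real (Z n ⁻¹' A) := by
    intro A
    simp only [mul_zero, zero_mul, Real.exp_zero, setIntegral_const, smul_eq_mul, mul_one]
  rw [hP, zero_add] at h4 h5
  have h6 : P.real (Z n ⁻¹' Γ) ≤ P.real (Z n ⁻¹' Set.Ici r) + P.real (Z n ⁻¹' Set.Iic (-r)) := by
    refine (measureReal_mono fun ω hω => ?_).trans (measureReal_union_le _ _)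
    rcases le_abs.1 (habs _ hω) with h | h
    · exact Or.inl h
    · exact Or.inr (show Z n ω ≤ -r by linarith)
  have h7 : ∀ M, M ≤ Real.exp (b n * (s * v ^ 2 / 2 + η)) →
      Real.exp (-(b n * (v * r))) * M ≤ Real.exp (b n * (-d + η)) := by
    intro M hM
    refine (mul_le_mul_of_nonneg_left hM (Real.exp_pos _).le).trans ?_
    rw [← Real.exp_add]
    refine Real.exp_le_exp.2 ?_
    have h8 : d ≤ s * v ^ 2 / 2 := by
      rw [hr_eq] at hr2
      nlinarith
    rw [hr_eq]
    nlinarith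
  have h8 : P.real (Z n ⁻¹' Γ) ≤ Real.exp (b n * c) := by
    have h9 := h7 _ h1
    rw [neg_sq] at h2
    have h10 := h7 _ h2
    have h11 : Real.exp (b n * (-d + η)) * 2 ≤ Real.exp (b n * c) := by
      have h12 : 2 ≤ Real.exp (b n * η) := by
        have := Real.add_one_le_exp (b n * η)
        rw [div_le_iff₀ hη] at hbn2
        linarith
      refine (mul_le_mul_of_nonneg_left h12 (Real.exp_pos _).le).trans ?_
      rw [← Real.exp_add]
      refine Real.exp_le_exp.2 ?_
      nlinarith
    linarith
  exact h8

/-- If the scaled cumulant generating functions of `Z n` converge to `s λ² / 2`, the `Z n` satisfy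
the large deviation principle with the Gaussian rate function `x² / (2 s)`. -/
theorem satisfiesLDP_of_tendsto_cgf {Ω : Type*} [MeasurableSpace Ω] (P : Measure Ω)
    [IsProbabilityMeasure P] {Z : ℕ → Ω → ℝ} (hZ : ∀ n, Measurable (Z n)) {b : ℕ → ℝ}
    (hb : Tendsto b atTop atTop) {s : ℝ} (hs : 0 < s)
    (hexp : ∀ n (u : ℝ), Integrable (fun ω => Real.exp (u * Z n ω)) P)
    (hlim : ∀ u : ℝ, Tendsto (fun n => cgf (Z n) P (b n * u) / b n) atTop (𝓝 (s * u ^ 2 / 2))) :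
    SatisfiesLDP P Z b (fun x => ((x ^ 2 / (2 * s) : ℝ) : EReal)) := by
  refine ⟨fun x => ?_, ?_, fun Γ hΓ => ?_, fun Γ hΓ => ?_⟩
  · exact EReal.coe_nonneg.2 (by positivity)
  · refine Continuous.lowerSemicontinuous ?_
    exact continuous_coe_real_ereal.comp (by fun_prop)
  · refine EReal.neg_le.1 (le_iInf₂ fun x hx => EReal.neg_le.1 ?_)
    refine EReal.ge_of_forall_gt_iff_ge.1 fun c hc => ?_
    rw [← EReal.coe_neg, EReal.coe_lt_coe_iff] at hc
    obtain ⟨δ, hδ, hball⟩ := Metric.isOpen_iff.1 isOpen_interior x hx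
    refine le_liminf_of_le (by isBoundedDefault) ?_
    filter_upwards [eventually_exp_le_measureReal_ball hZ hb hs hexp hlim hδ hc,
      hb.eventually_gt_atTop 0] with n h10 hbn
    rw [EReal.le_div_iff_mul_le (by exact_mod_cast hbn) (EReal.coe_ne_top _), ← EReal.coe_mul,
      ← Real.log_exp (c * b n), ← ENNReal.log_ofReal_of_pos (Real.exp_pos _)]
    refine ENNReal.log_le_log ?_
    rw [mul_comm c]
    refine (ENNReal.ofReal_le_ofReal h10).trans ?_
    rw [Measure.real, ENNReal.ofReal_toReal (measure_ne_top _ _)]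
    exact measure_mono (Set.preimage_mono (hball.trans interior_subset))
  · rw [← EReal.le_of_forall_lt_iff_le]
    intro c hc
    obtain ⟨c', hc', hc'c⟩ := EReal.lt_iff_exists_real_btwn.1 hc
    rw [EReal.coe_lt_coe_iff] at hc'c
    have hd' : ∀ x ∈ Γ, -c' < x ^ 2 / (2 * s) := by
      intro x hx
      have h1 := EReal.neg_lt_comm.1 hc'
      rw [← EReal.coe_neg] at h1
      exact EReal.coe_lt_coe_iff.1 (h1.trans_le (iInf₂_le x (subset_closure hx)))
    refine limsup_le_of_le (by isBoundedDefault) ?_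
    filter_upwards [eventually_measureReal_preimage_le_exp hZ hb hs hexp hlim hd' (c := c)
      (by linarith), hb.eventually_gt_atTop 0] with n h8 hbn
    rw [EReal.div_le_iff_le_mul (by exact_mod_cast hbn) (EReal.coe_ne_top _), ← EReal.coe_mul,
      ← Real.log_exp (b n * c), ← ENNReal.log_ofReal_of_pos (Real.exp_pos _)]
    refine ENNReal.log_le_log ?_
    rw [← ENNReal.ofReal_toReal (measure_ne_top P {ω | Z n ω ∈ Γ})]
    exact ENNReal.ofReal_le_ofReal h8

/-! ### Asymptotics of the Poissonized cumulant generating function -/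

/-- Second-order Taylor expansion of a Bernoulli cumulant generating function. The error must be
linear in `q`, so that its sum over all values is a multiple of `μ`. -/
theorem abs_log_bernoulli_mgf_sub_le {θ q : ℝ} (hθ : |θ| ≤ 1 / 4) (hq0 : 0 ≤ q) (hq1 : q ≤ 1) :
    |Real.log (1 + (Real.exp θ - 1) * q) - θ * q - θ ^ 2 / 2 * (q * (1 - q))|
      ≤ 20 * |θ| ^ 3 * q := by
  have hθ0 := abs_nonneg θ
  have hexp : |Real.exp θ - 1 - θ - θ ^ 2 / 2| ≤ |θ| ^ 3 := by
    have h := Real.exp_bound (x := θ) (by linarith) (n := 3) (by norm_num)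
    simp only [Finset.sum_range_succ, Finset.sum_range_zero] at h
    norm_num [Nat.factorial] at h
    rw [show Real.exp θ - 1 - θ - θ ^ 2 / 2 = Real.exp θ - (1 + θ + θ ^ 2 / 2) by ring]
    exact h.trans (by nlinarith [pow_nonneg hθ0 3])
  have hr : |Real.exp θ - 1 - θ| ≤ |θ| ^ 2 := by
    rw [sq_abs]
    exact Real.abs_exp_sub_one_sub_id_le (by linarith)
  set h := Real.exp θ - 1 with hh
  have hh2 : |h| ≤ 2 * |θ| := by
    have h1 : |h| ≤ |h - θ| + |θ| := by simpa using abs_add_le (h - θ) θ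
    nlinarith
  have hy : |h * q| ≤ 2 * |θ| * q := by
    rw [abs_mul, abs_of_nonneg hq0]
    exact mul_le_mul_of_nonneg_right hh2 hq0
  have hy2 : |h * q| ≤ 1 / 2 := by nlinarith
  -- The remainder is at most `|h q|³ / (1 - |h q|)`: the cube gives `8`, the denominator `2`.
  have hlog : |Real.log (1 + h * q) - h * q + (h * q) ^ 2 / 2| ≤ 16 * |θ| ^ 3 * q := by
    have h1 := Real.abs_log_sub_add_sum_range_le (x := -(h * q)) (by rw [abs_neg]; linarith) 2
    simp only [Finset.sum_range_succ, Finset.sum_range_zero, abs_neg] at h1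
    norm_num at h1
    rw [← abs_mul] at h1
    rw [show Real.log (1 + h * q) - h * q + (h * q) ^ 2 / 2
      = -(h * q) + (h * q) ^ 2 / 2 + Real.log (1 + h * q) by ring]
    refine h1.trans ?_
    rw [div_le_iff₀ (by linarith)]
    have h2 : |h * q| ^ 3 ≤ (2 * |θ| * q) ^ 3 := pow_le_pow_left₀ (abs_nonneg _) hy 3
    have h3 : q ^ 3 ≤ q := by
      have : q ^ 2 ≤ 1 := pow_le_one₀ hq0 hq1
      nlinarith
    have h4 : (2 * |θ| * q) ^ 3 ≤ 8 * |θ| ^ 3 * q := by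
      have := mul_le_mul_of_nonneg_left h3 (pow_nonneg hθ0 3)
      calc (2 * |θ| * q) ^ 3 = 8 * (|θ| ^ 3 * q ^ 3) := by ring
        _ ≤ _ := by linarith
    have h5 : 0 ≤ |θ| ^ 3 * q := by positivity
    nlinarith
  have hsq : |h ^ 2 - θ ^ 2| ≤ 3 * |θ| ^ 3 := by
    rw [show h ^ 2 - θ ^ 2 = (h - θ) * (h + θ) by ring, abs_mul]
    have h1 : |h + θ| ≤ 3 * |θ| := (abs_add_le _ _).trans (by linarith)
    calc |h - θ| * |h + θ| ≤ |θ| ^ 2 * (3 * |θ|) :=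
          mul_le_mul hr h1 (abs_nonneg _) (by positivity)
      _ = 3 * |θ| ^ 3 := by ring
  have hdec : Real.log (1 + h * q) - θ * q - θ ^ 2 / 2 * (q * (1 - q))
      = (Real.log (1 + h * q) - h * q + (h * q) ^ 2 / 2) + ((h - θ - θ ^ 2 / 2) * q
        + -((h ^ 2 - θ ^ 2) * (q ^ 2 / 2))) := by ring
  rw [hdec]
  refine (abs_add_le _ _).trans ?_
  have h1 : |(h - θ - θ ^ 2 / 2) * q + -((h ^ 2 - θ ^ 2) * (q ^ 2 / 2))|
      ≤ |θ| ^ 3 * q + 3 * |θ| ^ 3 * (q ^ 2 / 2) := by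
    refine (abs_add_le _ _).trans (add_le_add ?_ ?_)
    · rw [abs_mul, abs_of_nonneg hq0]
      exact mul_le_mul_of_nonneg_right hexp hq0
    · rw [abs_neg, abs_mul, abs_of_nonneg (by positivity : 0 ≤ q ^ 2 / 2)]
      exact mul_le_mul_of_nonneg_right hsq (by positivity)
  have h2 : q ^ 2 ≤ q := by nlinarith
  have h3 := mul_le_mul_of_nonneg_left h2 (pow_nonneg hθ0 3)
  have h4 : 0 ≤ |θ| ^ 3 * q := by positivity
  linarith

theorem mgf_normalizedRange {Ω : Type*} [MeasurableSpace Ω] (P : Measure Ω) (π : Measure ℕ+)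
    (ξ : ℕ → Ω → ℕ+) (b : ℕ → ℝ) (n : ℕ) (u : ℝ) :
    mgf (normalizedRange π ξ b n) P u = Real.exp (-(u / √(muFun π n * b n) * muFun π n)) *
      mgf (fun ω => (rangeCount ξ n ω : ℝ)) P (u / √(muFun π n * b n)) := by
  rw [mgf, mgf, ← integral_const_mul]
  refine integral_congr_ae (Eventually.of_forall fun ω => ?_)
  simp only [normalizedRange]
  rw [← Real.exp_add]
  ring_nf

section

variable {Ω : Type*} [MeasurableSpace Ω] {P : Measure Ω} [IsProbabilityMeasure P]
  {π : Measure ℕ+} [IsProbabilityMeasure π] {ξ : ℕ → Ω → ℕ+}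

theorem abs_log_poissonizedMgf_sub_le (hξ : ∀ k, Measurable (ξ k)) (hlaw : ∀ k, P.map (ξ k) = π)
    (hindep : iIndepFun ξ P) {t θ : ℝ} (ht : 0 ≤ t) (hθ : |θ| ≤ 1 / 4) :
    |Real.log (poissonizedMgf P ξ t θ) - θ * muFun π t
        - θ ^ 2 / 2 * (muFun π (2 * t) - muFun π t)| ≤ 20 * |θ| ^ 3 * muFun π t := by
  rw [poissonizedMgf_eq_exp_tsum hξ hlaw hindep ht, Real.log_exp]
  have h1 := (summable_muFun π ht).hasSum
  have h2 := (summable_muFun π (mul_nonneg two_pos.le ht)).hasSum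
  have h3 := ((summable_log_poissonized π ht θ).hasSum.sub (h1.mul_left θ)).sub
    ((h2.sub h1).mul_left (θ ^ 2 / 2))
  have h4 := h1.mul_left (20 * |θ| ^ 3)
  change |_ - θ * ∑' i, _ - θ ^ 2 / 2 * (∑' i, _ - ∑' i, _)| ≤ 20 * |θ| ^ 3 * ∑' i, _
  rw [← h3.tsum_eq, ← h4.tsum_eq, ← Real.norm_eq_abs]
  refine tsum_of_norm_bounded h4.summable.hasSum fun i => ?_
  have hq0 := one_sub_exp_neg_nonneg ht (measureReal_nonneg (μ := π) (s := {i}))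
  have h5 := abs_log_bernoulli_mgf_sub_le hθ hq0 (by linarith [Real.exp_pos (-t * π.real {i})])
  have h6 : Real.exp (-(2 * t) * π.real {i}) = Real.exp (-t * π.real {i}) ^ 2 := by
    rw [← Real.exp_nat_mul]; push_cast; ring_nf
  rw [Real.norm_eq_abs]
  convert! h5 using 4
  rw [h6]
  ring

theorem tendsto_log_poissonizedMgf (hξ : ∀ k, Measurable (ξ k)) (hlaw : ∀ k, P.map (ξ k) = π)
    (hindep : iIndepFun ξ P) {b : ℕ → ℝ} {ρ : ℝ} (hb : Tendsto b atTop atTop)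
    (hμb : Tendsto (fun n : ℕ => muFun π n / b n) atTop atTop)
    (hρ : Tendsto (fun n : ℕ => muFun π (2 * n) / muFun π n) atTop (𝓝 ρ)) {η : ℕ → ℝ}
    (hη : Tendsto η atTop (𝓝 0))
    (hημ : Tendsto (fun n : ℕ => |η n| * √(muFun π n / b n)) atTop (𝓝 0)) (u : ℝ) :
    Tendsto (fun n : ℕ => (Real.log (poissonizedMgf P ξ ((1 + η n) * n) (u * √(b n / muFun π n)))
      - u * √(b n / muFun π n) * muFun π n) / b n) atTop (𝓝 ((ρ - 1) * u ^ 2 / 2)) := by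
  have hμpos : ∀ᶠ n : ℕ in atTop, 0 < muFun π n := by
    filter_upwards [hμb.eventually_gt_atTop 0, hb.eventually_gt_atTop 0] with n h1 h2
    exact (div_pos_iff_of_pos_right h2).1 h1
  have hη1 : ∀ᶠ n in atTop, |η n| ≤ 1 := by
    have h := hη.abs
    rw [abs_zero] at h
    exact (h.eventually (gt_mem_nhds one_pos)).mono fun n hn => hn.le
  have hη0 := hη.abs
  rw [abs_zero] at hη0
  have hr : Tendsto (fun n : ℕ => √(b n / muFun π n)) atTop (𝓝 0) := by
    have h := hμb.inv_tendsto_atTop.sqrt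
    rw [Real.sqrt_zero] at h
    refine h.congr fun n => ?_
    rw [Pi.inv_apply, inv_div]
  have hratio1 : Tendsto (fun n : ℕ => muFun π ((1 + η n) * n) / muFun π n) atTop (𝓝 1) := by
    refine tendsto_iff_norm_sub_tendsto_zero.2 (squeeze_zero' (Eventually.of_forall fun _ =>
      norm_nonneg _) ?_ hη0)
    filter_upwards [hη1, hμpos] with n h1 h2
    rw [div_sub_one h2.ne', norm_div, Real.norm_of_nonneg h2.le, div_le_iff₀ h2]
    exact abs_muFun_sub_le π h1 (Nat.cast_nonneg n)
  have hratio2 : Tendsto (fun n : ℕ => muFun π (2 * ((1 + η n) * n)) / muFun π n) atTop (𝓝 ρ) := by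
    have h1 : Tendsto (fun n : ℕ => muFun π (2 * ((1 + η n) * n)) / muFun π (2 * n)) atTop (𝓝 1) := by
      refine tendsto_iff_norm_sub_tendsto_zero.2 (squeeze_zero' (Eventually.of_forall fun _ =>
        norm_nonneg _) ?_ hη0)
      filter_upwards [hη1, hμpos] with n h1 h2
      have h3 : 0 < muFun π (2 * n) :=
        h2.trans_le (muFun_mono π (Nat.cast_nonneg n) (by linarith [(Nat.cast_nonneg n : (0 : ℝ) ≤ n)]))
      rw [div_sub_one h3.ne', norm_div, Real.norm_of_nonneg h3.le, div_le_iff₀ h3, mul_left_comm]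
      exact abs_muFun_sub_le π h1 (by positivity)
    have h2 := h1.mul hρ
    rw [one_mul] at h2
    refine h2.congr' ?_
    filter_upwards [hμpos] with n h2
    have h3 : 0 < muFun π (2 * n) :=
      h2.trans_le (muFun_mono π (Nat.cast_nonneg n) (by linarith [(Nat.cast_nonneg n : (0 : ℝ) ≤ n)]))
    field_simp
  have herr1 : Tendsto (fun n : ℕ => 20 * |u| ^ 3 * √(b n / muFun π n)
      * (muFun π ((1 + η n) * n) / muFun π n)) atTop (𝓝 0) := by
    simpa using (hr.const_mul (20 * |u| ^ 3)).mul hratio1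
  have herr2 : Tendsto (fun n : ℕ => |u| * (|η n| * √(muFun π n / b n))) atTop (𝓝 0) := by
    simpa using hημ.const_mul |u|
  have hmain := (hratio2.sub hratio1).const_mul (u ^ 2 / 2)
  rw [show u ^ 2 / 2 * (ρ - 1) = (ρ - 1) * u ^ 2 / 2 by ring] at hmain
  have herr : Tendsto (fun n : ℕ =>
      ((Real.log (poissonizedMgf P ξ ((1 + η n) * n) (u * √(b n / muFun π n)))
      - u * √(b n / muFun π n) * muFun π n) / b n)
      - u ^ 2 / 2 * (muFun π (2 * ((1 + η n) * n)) / muFun π n - muFun π ((1 + η n) * n) / muFun π n))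
      atTop (𝓝 0) := by
    have hθ : ∀ᶠ n : ℕ in atTop, |u * √(b n / muFun π n)| < 1 / 4 := by
      have h := (hr.const_mul u).abs
      rw [mul_zero, abs_zero] at h
      exact h.eventually (gt_mem_nhds (by norm_num))
    refine squeeze_zero_norm' ?_ (by simpa using herr1.add herr2)
    filter_upwards [hθ, hη1, hμpos, hb.eventually_gt_atTop 0] with n h1 h2 h3 h4
    have ht : 0 ≤ (1 + η n) * (n : ℝ) :=
      mul_nonneg (by linarith [(abs_le.1 h2).1]) (Nat.cast_nonneg n)
    have h5 := abs_log_poissonizedMgf_sub_le (P := P) (π := π) hξ hlaw hindep ht h1.le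
    have h6 := abs_muFun_sub_le π h2 (Nat.cast_nonneg n : (0 : ℝ) ≤ n)
    set M := muFun π n
    set M1 := muFun π ((1 + η n) * n)
    set M2 := muFun π (2 * ((1 + η n) * n))
    set r := √(b n / M) with hr'
    set G := Real.log (poissonizedMgf P ξ ((1 + η n) * n) (u * r))
    have hr0 : 0 < r := Real.sqrt_pos.2 (by positivity)
    have hr2 : r ^ 2 = b n / M := Real.sq_sqrt (by positivity)
    have hbr : b n = r ^ 2 * M := by rw [hr2]; field_simp
    have hrinv : √(M / b n) = r⁻¹ := by rw [hr', ← Real.sqrt_inv, inv_div]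
    -- The error splits into the Taylor remainder at the perturbed time and the displacement of the
    -- centring from `M` to `M1`.
    have hdec : (G - u * r * M) / b n - u ^ 2 / 2 * (M2 / M - M1 / M)
        = (G - u * r * M1 - (u * r) ^ 2 / 2 * (M2 - M1)) / b n + u * (r * (M1 - M)) / b n := by
      rw [hbr]
      field_simp
      ring
    rw [hdec, hrinv]
    refine (norm_add_le _ _).trans (add_le_add ?_ ?_)
    · rw [Real.norm_eq_abs, abs_div, abs_of_pos h4, div_le_iff₀ h4]
      refine h5.trans (le_of_eq ?_)
      rw [abs_mul, abs_of_pos hr0, hbr]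
      field_simp
    · rw [Real.norm_eq_abs, abs_div, abs_of_pos h4, div_le_iff₀ h4, abs_mul, abs_mul, abs_of_pos hr0,
        hbr]
      have h7 := mul_le_mul_of_nonneg_left h6 (by positivity : 0 ≤ |u| * r)
      refine (le_of_eq (by ring)).trans (h7.trans (le_of_eq ?_))
      field_simp
  have h := herr.add hmain
  rw [zero_add] at h
  exact h.congr fun n => by ring

theorem poissonizedMgf_pos (hξ : ∀ k, Measurable (ξ k)) (hlaw : ∀ k, P.map (ξ k) = π)
    (hindep : iIndepFun ξ P) {t : ℝ} (ht : 0 ≤ t) (θ : ℝ) : 0 < poissonizedMgf P ξ t θ := by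
  rw [poissonizedMgf_eq_exp_tsum hξ hlaw hindep ht]
  exact Real.exp_pos _

/-- The scaled cumulant generating function of the centred range converges. -/
theorem tendsto_cgf_rangeCount (hξ : ∀ k, Measurable (ξ k)) (hlaw : ∀ k, P.map (ξ k) = π)
    (hindep : iIndepFun ξ P) {b : ℕ → ℝ} {ρ : ℝ} (hb : Tendsto b atTop atTop)
    (hμb : Tendsto (fun n : ℕ => muFun π n / b n) atTop atTop)
    (hρ : Tendsto (fun n : ℕ => muFun π (2 * n) / muFun π n) atTop (𝓝 ρ)) {u : ℝ} (hu : u ≠ 0) :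
    Tendsto (fun n : ℕ => (cgf (fun ω => (rangeCount ξ n ω : ℝ)) P (u * √(b n / muFun π n))
      - u * √(b n / muFun π n) * muFun π n) / b n) atTop (𝓝 ((ρ - 1) * u ^ 2 / 2)) := by
  have hμpos : ∀ᶠ n : ℕ in atTop, 0 < muFun π n := by
    filter_upwards [hμb.eventually_gt_atTop 0, hb.eventually_gt_atTop 0] with n h1 h2
    exact (div_pos_iff_of_pos_right h2).1 h1
  have hsub : Tendsto (fun n : ℕ => muFun π n / n) atTop (𝓝 0) :=
    (tendsto_muFun_div_atTop π).comp tendsto_natCast_atTop_atTop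
  -- The perturbation of the time parameter satisfies `√(b / n) ≪ ε ≪ √(b / μ)`.
  obtain ⟨ε, hε_def⟩ : ∃ ε : ℕ → ℝ, ∀ n, ε n = √(b n / √(n * muFun π n)) := ⟨_, fun _ => rfl⟩
  have hε0 : ∀ᶠ n in atTop, 0 < ε n := by
    filter_upwards [hμpos, hb.eventually_gt_atTop 0, eventually_gt_atTop 0] with n h1 h2 h3
    have : (0 : ℝ) < n := by exact_mod_cast h3
    rw [hε_def]
    positivity
  -- The expression equals `(μ(n)/n)^{1/4}`.
  have hεμ : Tendsto (fun n : ℕ => ε n * √(muFun π n / b n)) atTop (𝓝 0) := by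
    have h := hsub.sqrt.sqrt
    rw [Real.sqrt_zero, Real.sqrt_zero] at h
    refine h.congr' ?_
    filter_upwards [hμpos, hb.eventually_gt_atTop 0, eventually_gt_atTop 0] with n h1 h2 h3
    have h3' : (0 : ℝ) < n := by exact_mod_cast h3
    rw [hε_def, ← Real.sqrt_mul (by positivity)]
    congr 1
    rw [div_mul_div_comm, mul_comm (√_), mul_div_mul_left _ _ h2.ne',
      Real.sqrt_div h1.le, Real.sqrt_mul h3'.le]
    have h4 : √(muFun π n) ≠ 0 := (Real.sqrt_pos.2 h1).ne'
    have h5 : √(n : ℝ) ≠ 0 := (Real.sqrt_pos.2 h3').ne'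
    rw [div_eq_div_iff h5 (by positivity), ← mul_assoc, mul_comm (√(muFun π n)), mul_assoc,
      Real.mul_self_sqrt h1.le, mul_comm]
  have hε : Tendsto ε atTop (𝓝 0) := by
    have h := hεμ.mul (hμb.inv_tendsto_atTop.sqrt)
    rw [zero_mul] at h
    refine h.congr' ?_
    filter_upwards [hμb.eventually_gt_atTop 0] with n h1
    rw [Pi.inv_apply, Real.sqrt_inv, mul_assoc, mul_inv_cancel₀ (Real.sqrt_pos.2 h1).ne', mul_one]
  -- The expression equals `√(n/μ(n)) / 8`.
  have hεn : Tendsto (fun n : ℕ => n * ε n ^ 2 / 8 / b n) atTop atTop := by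
    have h1 : Tendsto (fun n : ℕ => √(muFun π n / n)) atTop (𝓝[>] 0) := by
      refine tendsto_nhdsWithin_iff.2 ⟨?_, ?_⟩
      · simpa using hsub.sqrt
      · filter_upwards [hμpos, eventually_gt_atTop 0] with n h1 h3
        have h3' : (0 : ℝ) < n := by exact_mod_cast h3
        exact Real.sqrt_pos.2 (by positivity)
    refine (h1.inv_tendsto_nhdsGT_zero.atTop_div_const (by norm_num : (0 : ℝ) < 8)).congr' ?_
    filter_upwards [hμpos, hb.eventually_gt_atTop 0, eventually_gt_atTop 0] with n h1 h2 h3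
    have h3' : (0 : ℝ) < n := by exact_mod_cast h3
    rw [hε_def, Real.sq_sqrt (by positivity), Pi.inv_apply, Real.sqrt_div h1.le, Real.sqrt_mul h3'.le]
    have h4 : 0 < √(muFun π n) := Real.sqrt_pos.2 h1
    have h5 : 0 < √(n : ℝ) := Real.sqrt_pos.2 h3'
    have h6 : (n : ℝ) = √(n : ℝ) * √(n : ℝ) := (Real.mul_self_sqrt h3'.le).symm
    rw [inv_div]
    field_simp
    nlinarith
  have hε_half : ∀ᶠ n in atTop, ε n ≤ 1 / 2 :=
    (hε.eventually (gt_mem_nhds (by norm_num : (0 : ℝ) < 1 / 2))).mono fun n hn => hn.le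
  -- The shift `σ ε` follows the sign of `θ` and gives the upper bound; `-σ ε` gives the lower
  -- bound.
  set σ := SignType.sign u with hσ
  have hσ1 : |((σ : SignType) : ℝ)| = 1 := by
    rcases hu.lt_or_gt with h | h
    · simp [hσ, sign_neg h]
    · simp [hσ, sign_pos h]
  have hσu : u * (σ : ℝ) = |u| := self_mul_sign u
  have hη : ∀ τ : ℝ, |τ| = 1 → Tendsto (fun n => τ * ε n) atTop (𝓝 0) ∧
      Tendsto (fun n : ℕ => |τ * ε n| * √(muFun π n / b n)) atTop (𝓝 0) := by
    intro τ hτ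
    refine ⟨by simpa using hε.const_mul τ, hεμ.congr' ?_⟩
    filter_upwards [hε0] with n hn
    rw [abs_mul, hτ, one_mul, abs_of_pos hn]
  have hG := fun (τ : ℝ) (hτ : |τ| = 1) (v : ℝ) =>
    tendsto_log_poissonizedMgf (P := P) (π := π) hξ hlaw hindep hb hμb hρ (hη τ hτ).1 (hη τ hτ).2 v
  have hσ1' : |-(σ : ℝ)| = 1 := by rw [abs_neg, hσ1]
  have hlog2 : Tendsto (fun n => Real.log 2 / b n) atTop (𝓝 0) := hb.const_div_atTop _
  have hup := (hG σ hσ1 u).add hlog2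
  have hlow := (hG (-σ) hσ1' u).sub hlog2
  rw [add_zero] at hup
  rw [sub_zero] at hlow
  have hexp_small : ∀ᶠ n : ℕ in atTop, Real.exp (-(n * ε n ^ 2 / 8)) ≤ 1 / 2 := by
    filter_upwards [hεn.eventually_ge_atTop 1, hb.eventually_ge_atTop 1] with n h1 h2
    rw [le_div_iff₀ (by linarith)] at h1
    have h3 := Real.add_one_le_exp ((n : ℝ) * ε n ^ 2 / 8)
    rw [Real.exp_neg, ← one_div]
    exact one_div_le_one_div_of_le (by norm_num) (by linarith)
  refine tendsto_of_tendsto_of_tendsto_of_le_of_le' hlow hup ?_ ?_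
  · have hlog4 : Tendsto (fun n => Real.log 4 / b n) atTop (𝓝 0) := hb.const_div_atTop _
    -- The centring terms cancel, so `log G(2θ) - 2 log G(θ)` is `O(b)`, which `n ε²/8` eventually
    -- exceeds.
    have hdiff := ((hG (-σ) hσ1' (2 * u)).sub ((hG (-σ) hσ1' u).const_mul 2)).add hlog4
    filter_upwards [hdiff.eventually (gt_mem_nhds (lt_add_one _)), hεn.eventually_ge_atTop
        ((ρ - 1) * (2 * u) ^ 2 / 2 - 2 * ((ρ - 1) * u ^ 2 / 2) + 0 + 1),
      hε0, hε_half, hb.eventually_gt_atTop 0] with n h1 h2 h3 h4 h5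
    have hη_half : |-(σ : ℝ) * ε n| ≤ 1 / 2 := by rwa [abs_mul, hσ1', one_mul, abs_of_pos h3]
    have ht : 0 ≤ (1 + -(σ : ℝ) * ε n) * (n : ℝ) :=
      mul_nonneg (by linarith [(abs_le.1 hη_half).1]) (Nat.cast_nonneg n)
    have h6 := h1.le.trans h2
    set θ := u * √(b n / muFun π n) with hθ
    rw [show 2 * u * √(b n / muFun π n) = 2 * θ by rw [hθ]; ring] at h6
    have hG0 := poissonizedMgf_pos (P := P) (π := π) hξ hlaw hindep ht θ
    have hG2 := poissonizedMgf_pos (P := P) (π := π) hξ hlaw hindep ht (2 * θ)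
    -- With `a = 2 G(2θ)/G(θ)` the last error term is exactly `G(θ)/4` and the other is at most
    -- `G(θ)/4`, so half of `G(θ)` remains.
    have h7 := poissonizedMgf_le (P := P) hξ hη_half ?_ (θ := θ) ?_ n
      (a := 2 * poissonizedMgf P ξ ((1 + -(σ : ℝ) * ε n) * n) (2 * θ) /
        poissonizedMgf P ξ ((1 + -(σ : ℝ) * ε n) * n) θ) (by positivity)
    · set G := poissonizedMgf P ξ ((1 + -(σ : ℝ) * ε n) * n) θ with hGdef
      set G' := poissonizedMgf P ξ ((1 + -(σ : ℝ) * ε n) * n) (2 * θ) with hG'def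
      have hsq : (-(σ : ℝ) * ε n) ^ 2 = ε n ^ 2 := by
        rw [mul_pow, ← sq_abs (-(σ : ℝ)), hσ1', one_pow, one_mul]
      rw [hsq] at h7
      have h8 : Real.log G' + Real.log 4 - 2 * Real.log G ≤ n * ε n ^ 2 / 8 := by
        rw [mul_div_assoc', ← sub_div, ← add_div, div_le_div_iff_of_pos_right h5] at h6
        linarith
      have h9 : Real.exp (-(n * ε n ^ 2 / 8)) ≤ G ^ 2 / (4 * G') := by
        rw [← Real.le_log_iff_exp_le (by positivity), Real.log_div (by positivity) (by positivity),
          Real.log_pow, Real.log_mul (by norm_num) hG2.ne']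
        push_cast
        linarith
      have h10 : 2 * G' / G / 2 * Real.exp (-(n * ε n ^ 2 / 8)) ≤ G / 4 := by
        refine (mul_le_mul_of_nonneg_left h9 (by positivity)).trans (le_of_eq ?_)
        field_simp
      have h11 : G' / (2 * (2 * G' / G)) = G / 4 := by
        field_simp
        norm_num
      have h12 : G / 2 ≤ mgf (fun ω => (rangeCount ξ n ω : ℝ)) P θ := by linarith
      have h13 := Real.log_le_log (by positivity) h12
      rw [Real.log_div hG0.ne' two_ne_zero] at h13
      rw [← sub_div, div_le_div_iff_of_pos_right h5, cgf]
      linarith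
    · exact mul_ne_zero (by rw [← abs_ne_zero, hσ1']; exact one_ne_zero) h3.ne'
    · have : θ * (-(σ : ℝ) * ε n) = -(|u| * √(b n / muFun π n) * ε n) := by
        rw [← hσu, hθ]; ring
      rw [this, neg_nonpos]
      positivity
  · filter_upwards [hexp_small, hε0, hε_half, hb.eventually_gt_atTop 0] with n h2 h3 h4 h5
    have hη_half : |(σ : ℝ) * ε n| ≤ 1 / 2 := by rwa [abs_mul, hσ1, one_mul, abs_of_pos h3]
    have ht : 0 ≤ (1 + (σ : ℝ) * ε n) * (n : ℝ) :=
      mul_nonneg (by linarith [(abs_le.1 hη_half).1]) (Nat.cast_nonneg n)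
    set θ := u * √(b n / muFun π n) with hθ
    have hG0 := poissonizedMgf_pos (P := P) (π := π) hξ hlaw hindep ht θ
    have h7 := mgf_rangeCount_mul_le_poissonizedMgf (P := P) hξ hη_half ?_ (θ := θ) ?_ n
    · set G := poissonizedMgf P ξ ((1 + (σ : ℝ) * ε n) * n) θ with hGdef
      have hsq : ((σ : ℝ) * ε n) ^ 2 = ε n ^ 2 := by
        rw [mul_pow, ← sq_abs (σ : ℝ), hσ1, one_pow, one_mul]
      rw [hsq] at h7
      have hL : 0 < mgf (fun ω => (rangeCount ξ n ω : ℝ)) P θ :=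
        mgf_pos (integrable_exp_rangeCount hξ n θ)
      have h8 : mgf (fun ω => (rangeCount ξ n ω : ℝ)) P θ ≤ G * 2 := by nlinarith
      have h9 := Real.log_le_log hL h8
      rw [Real.log_mul hG0.ne' two_ne_zero] at h9
      rw [← add_div, div_le_div_iff_of_pos_right h5, cgf]
      linarith
    · exact mul_ne_zero (by rw [← abs_ne_zero, hσ1]; exact one_ne_zero) h3.ne'
    · have : θ * ((σ : ℝ) * ε n) = |u| * √(b n / muFun π n) * ε n := by
        rw [← hσu, hθ]; ring
      rw [this]
      positivity

theorem tendsto_cgf_normalizedRange (hξ : ∀ k, Measurable (ξ k)) (hlaw : ∀ k, P.map (ξ k) = π)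
    (hindep : iIndepFun ξ P) {b : ℕ → ℝ} {ρ : ℝ} (hb : Tendsto b atTop atTop)
    (hμb : Tendsto (fun n : ℕ => muFun π n / b n) atTop atTop)
    (hρ : Tendsto (fun n : ℕ => muFun π (2 * n) / muFun π n) atTop (𝓝 ρ)) (u : ℝ) :
    Tendsto (fun n : ℕ => cgf (normalizedRange π ξ b n) P (b n * u) / b n) atTop
      (𝓝 ((ρ - 1) * u ^ 2 / 2)) := by
  -- `u = 0` is separate: its sign would give no time shift.
  rcases eq_or_ne u 0 with rfl | hu
  · simp
  refine (tendsto_cgf_rangeCount hξ hlaw hindep hb hμb hρ hu).congr' ?_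
  filter_upwards [hμb.eventually_gt_atTop 0, hb.eventually_gt_atTop 0] with n h1 h2
  have hμ : 0 < muFun π n := (div_pos_iff_of_pos_right h2).1 h1
  have hθ : b n * u / √(muFun π n * b n) = u * √(b n / muFun π n) := by
    have h3 : 0 < √(muFun π n) := Real.sqrt_pos.2 hμ
    have h4 : 0 < √(b n) := Real.sqrt_pos.2 h2
    rw [Real.sqrt_mul hμ.le, Real.sqrt_div h2.le, mul_div_assoc', div_eq_div_iff (by positivity) h3.ne']
    have h5 := Real.mul_self_sqrt h2.le
    linear_combination (-u * √(muFun π n)) * h5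
  rw [cgf, cgf, mgf_normalizedRange, hθ, Real.log_mul (Real.exp_pos _).ne'
    (mgf_pos (integrable_exp_rangeCount hξ n _)).ne', Real.log_exp]
  ring

end

/-! ### The large deviation principle for the range -/

theorem theorem1p2 {Ω : Type*} [MeasurableSpace Ω] (P : Measure Ω) [IsProbabilityMeasure P]
    (π : Measure ℕ+) [IsProbabilityMeasure π]
    (hπ_pos : ∀ i : ℕ+, 0 < π.real {i})
    (hπ_anti : ∀ i : ℕ+, π.real {i + 1} ≤ π.real {i})
    (ξ : ℕ → Ω → ℕ+) (hξ_meas : ∀ k, Measurable (ξ k))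
    (hξ_law : ∀ k, P.map (ξ k) = π) (hξ_indep : iIndepFun ξ P)
    (γ : ℝ) (hγ_pos : 0 < γ) (hγ_lt : γ < 1) (hreg : IsRegularDistribution γ π)
    (b : ℕ → ℝ) (hb_pos : ∀ n, 1 ≤ n → 0 < b n) (hb : Tendsto b atTop atTop)
    (hμb : Tendsto (fun n : ℕ => muFun π n / b n) atTop atTop) :
    SatisfiesLDP P (normalizedRange π ξ b) b
      (fun x => ((x ^ 2 / (2 * ((2 : ℝ) ^ γ - 1)) : ℝ) : EReal)) := by
  have hanti : Antitone fun i : ℕ+ => π.real {i} := by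
    have h : Antitone fun m : ℕ => π.real {m.succPNat} := antitone_nat_of_succ_le fun m => by
      have := hπ_anti m.succPNat
      rwa [show m.succPNat + 1 = (m + 1).succPNat from rfl] at this
    intro i j hij
    have h1 := h (Nat.sub_le_sub_right (show (i : ℕ) ≤ j from hij) 1)
    have h2 : ∀ k : ℕ+, ((k : ℕ) - 1).succPNat = k := PNat.succPNat_natPred
    simpa only [h2] using h1
  have hμn : Tendsto (fun n : ℕ => muFun π n) atTop atTop := by
    refine (hμb.atTop_mul_atTop₀ hb).congr' ?_
    filter_upwards [hb.eventually_gt_atTop 0] with n hn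
    exact div_mul_cancel₀ _ hn.ne'
  -- Divergence along the integers passes to real times by monotonicity.
  have hμ : Tendsto (muFun π) atTop atTop := by
    refine tendsto_atTop.2 fun M => ?_
    obtain ⟨n, hn⟩ := (hμn.eventually_ge_atTop M).exists
    filter_upwards [eventually_ge_atTop (n : ℝ)] with t ht
    exact hn.trans (muFun_mono π (Nat.cast_nonneg n) ht)
  have hρ := (tendsto_muFun_two_mul_div hγ_pos π hπ_pos hanti hreg hμ).comp
    (tendsto_natCast_atTop_atTop (R := ℝ))
  have hmeas : ∀ n, Measurable (normalizedRange π ξ b n) := fun n =>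
    ((measurable_rangeCount hξ_meas n).sub_const _).div_const _
  refine satisfiesLDP_of_tendsto_cgf P hmeas hb
    (sub_pos.2 (Real.one_lt_rpow one_lt_two hγ_pos)) (fun n u => ?_)
    (tendsto_cgf_normalizedRange hξ_meas hξ_law hξ_indep hb hμb hρ)
  have h := (integrable_exp_rangeCount (P := P) hξ_meas n (u / √(muFun π n * b n))).const_mul
    (Real.exp (-(u / √(muFun π n * b n) * muFun π n)))
  refine h.congr (Eventually.of_forall fun ω => ?_)
  simp only [normalizedRange]
  rw [← Real.exp_add]
  ring_nf
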